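/- Let $c\ge 1$, let $\alpha_1,\dots,\alpha_c>0$ be constants, and let $x=(x_1,\dots,x_c)\neq 0$ with all $x_i\ge 0$. Let $\mathbf X(t)=(X_1(t),\dots,X_c(t))$, $t\ge 0$, be the continuum Pólya-like random walk with starting point $\mathbf X(0)=x$ and diagonal navigation matrix $\mathrm{diag}(\alpha_1,\dots,\alpha_c)$ (the component-wise constant Pólya–Eggenberger-like walk). That is, $\mathbf X$ is the piecewise constant jump process such that, given the history up to a renewal after which the position is $S$, the waiting time until the next renewal is exponential with rate $\sum_j S_j$; independently of this waiting time, the next renewal has type $i$ with probability $S_i/\sum_j S_j$; and a renewal of type $i$ adds $\alpha_i$ to the $i$th coordinate and leaves the other coordinates unchanged. Then the following hold. 1. For every $i$, every $t\ge 0$ and every real $u$ with $1-e^{\alpha_i t}(1-e^{-\alpha_i u})>0$, the variable $e^{uX_i(t)}$ is integrable and $$\mathbb E\big[e^{uX_i(t)}\big]=\bigl(1-e^{\alpha_i t}(1-e^{-\alpha_i u})\bigr)^{-x_i/\alpha_i}.$$ 2. For every $i$ and every real $s$ with $\alpha_i s<1$, $$\lim_{t\to\infty}\mathbb E\Bigl[\exp\Bigl(\frac{sX_i(t)}{e^{\alpha_i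 t}}\Bigr)\Bigr]=(1-\alpha_i s)^{-x_i/\alpha_i}.$$ 3. For every $i$, as $t\to\infty$, $X_i(t)/e^{\alpha_i t}$ converges in distribution to the gamma distribution with shape $x_i/\alpha_i$ and scale $\alpha_i$ (the point mass at $0$ if $x_i=0$). 4. As $t\to\infty$, the random vector $\bigl(X_1(t)/e^{\alpha_1 t},\dots,X_c(t)/e^{\alpha_c t}\bigr)$ converges in distribution to a random vector with independent coordinates, whose $i$th coordinate has the gamma distribution in 3; that is, the limit law is the product of these distributions. -/

import Mathlib

open MeasureTheory ProbabilityTheory Filter Topology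
open scoped NNReal

noncomputable section

/-- Position of the walk after `n` renewals: it starts at `x`, and a renewal of type `i` adds row `i`
of the navigation matrix `A`. Here `I k` is the type of the `k`-th renewal (counting from `0`). -/
def polyaPosition {Ω : Type*} {c : ℕ} (A : Matrix (Fin c) (Fin c) ℝ) (x : Fin c → ℝ)
    (I : ℕ → Ω → Fin c) (n : ℕ) (ω : Ω) : Fin c → ℝ :=
  x + ∑ k ∈ Finset.range n, A.row (I k ω)

/-- Time of the `n`-th renewal, where `W k` is the `k`-th waiting time; the zeroth one is time `0`. -/
def renewalEpoch {Ω : Type*} (W : ℕ → Ω → ℝ) (n : ℕ) (ω : Ω) : ℝ :=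
  ∑ k ∈ Finset.range n, W k ω

/-- The σ-algebra generated by the first `n` waiting times and the first `n` renewal types. -/
abbrev renewalHistory {Ω : Type*} {c : ℕ} (W : ℕ → Ω → ℝ) (I : ℕ → Ω → Fin c) (n : ℕ) :
    MeasurableSpace Ω :=
  MeasurableSpace.comap (fun ω (k : Fin n) => (W k ω, I k ω)) inferInstance

/-- `W` (waiting times) and `I` (renewal types) drive the process `X` as a continuum Pólya-like walk
with navigation matrix `A` and starting point `x`. Given the history of the first `n` renewals, with
`S` the current position and `|S| = ∑ j, S j`, the next waiting time is exponential with rate `|S|`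
and, independently of it, the next renewal has type `i` with probability `S i / |S|`. The process
stays at the current position until the next renewal. -/
structure IsDrivenBy {Ω : Type*} [MeasurableSpace Ω] {c : ℕ} (P : Measure Ω)
    (A : Matrix (Fin c) (Fin c) ℝ) (x : Fin c → ℝ) (X : ℝ≥0 → Ω → Fin c → ℝ)
    (W : ℕ → Ω → ℝ) (I : ℕ → Ω → Fin c) : Prop where
  measurable_wait : ∀ n, Measurable (W n)
  measurable_type : ∀ n, Measurable (I n)
  condProb_renewal : ∀ (n : ℕ) (i : Fin c) (w : ℝ), 0 ≤ w →
    P⟦{ω | w < W n ω ∧ I n ω = i} | renewalHistory W I n⟧ =ᵐ[P]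
      fun ω => Real.exp (-(w * ∑ j, polyaPosition A x I n ω j)) *
        (polyaPosition A x I n ω i / ∑ j, polyaPosition A x I n ω j)
  path_eq : ∀ᵐ ω ∂P, ∀ (n : ℕ) (t : ℝ≥0),
    renewalEpoch W n ω ≤ t → (t : ℝ) < renewalEpoch W (n + 1) ω →
      X t ω = polyaPosition A x I n ω

/-- `X` is, under `P`, a continuum Pólya-like random walk with (deterministic) navigation matrix `A`
and starting point `x`. (For a tenable pair `A`, `x`, that is, one for which the walk keeps
nonnegative coordinates and avoids the origin.) -/
def IsContinuumPolyaWalk {Ω : Type*} [MeasurableSpace Ω] {c : ℕ} (P : Measure Ω)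
    (A : Matrix (Fin c) (Fin c) ℝ) (x : Fin c → ℝ) (X : ℝ≥0 → Ω → Fin c → ℝ) : Prop :=
  ∃ (W : ℕ → Ω → ℝ) (I : ℕ → Ω → Fin c), IsDrivenBy P A x X W I

open Classical in
/-- The gamma distribution with shape `k` and scale `θ`, whose moment generating function is
`s ↦ (1 - θ * s) ^ (-k)` for `θ * s < 1`. Mathlib's `gammaMeasure` takes the shape and the rate.
Shape `0` is the degenerate case of the point mass at `0`. -/
def gammaLaw (k θ : ℝ) : Measure ℝ :=
  if 0 < k ∧ 0 < θ then gammaMeasure k θ⁻¹ else Measure.dirac 0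

instance gammaLaw_isProbabilityMeasure (k θ : ℝ) : IsProbabilityMeasure (gammaLaw k θ) := by
  unfold gammaLaw
  split_ifs with h
  · exact isProbabilityMeasure_gammaMeasure h.1 (inv_pos.mpr h.2)
  · infer_instance

end

/-!
Fix `u` and let `F τ y` be the claimed value
`∏ i, (1 - e^{α i τ} (1 - e^{-α i u i})) ^ (-y i / α i)` of `𝔼 exp (∑ i, u i X i(τ))` for the walk
started at `y`. It solves the backward equation of the walk, hence, by variation of constants, the
equation obtained by conditioning on the first renewal. Iterating the latter along the renewals of
the actual walk writes `F t x` as the contribution of the paths with fewer than `n` renewals by time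
`t` plus a remainder. The sum `∑ i, X i / α i` grows by exactly `1` at each renewal, so replacing
`u i` by the slightly larger `u i + ε / α i` costs a factor at least `e^{εn}` after `n` renewals:
the remainder is at most `e^{-εn}` times a finite constant. For `u = 0` this shows that the walk
does not explode; for general `u` it identifies the joint moment generating function.

After the substitution `u i = s i e^{-α i t}` the base tends to `1 - α i s i`, and the limit is the
moment generating function of a product of gamma laws. Some exponential moments stay bounded, so the
scaled walks are tight, and on the nonnegative orthant the functions `y ↦ exp (-∑ i, s i y i)` span
a point-separating algebra, so convergence of Laplace transforms gives convergence in distribution.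
-/

section ExponentialLaw

lemma expMeasure_Ioi {r : ℝ} (hr : 0 < r) (w : ℝ) :
    expMeasure r (Set.Ioi w) = ENNReal.ofReal (Real.exp (-(r * max w 0))) := by
  have := isProbabilityMeasure_expMeasure hr
  rw [← Set.compl_Iic, prob_compl_eq_one_sub measurableSet_Iic, ← ofReal_cdf, cdf_expMeasure_eq hr]
  split_ifs with hw
  · rw [max_eq_left hw, ← ENNReal.ofReal_one,
      ← ENNReal.ofReal_sub _ (by simpa using mul_nonneg hr.le hw), sub_sub_cancel]
  · simp [max_eq_right (not_le.1 hw).le]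

lemma ae_expMeasure_pos {r : ℝ} (hr : 0 < r) : ∀ᵐ w ∂expMeasure r, 0 < w := by
  have := isProbabilityMeasure_expMeasure hr
  exact (prob_compl_eq_zero_iff measurableSet_Ioi).2 (by simpa using expMeasure_Ioi hr 0)

lemma expMeasure_eq_withDensity (r : ℝ) :
    expMeasure r = (volume.restrict (Set.Ioi 0)).withDensity
      fun w => ENNReal.ofReal (r * Real.exp (-(r * w))) := by
  rw [Measure.restrict_congr_set Ioi_ae_eq_Ici, ← withDensity_indicator measurableSet_Ici]
  change volume.withDensity (exponentialPDF r) = _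
  congr 1
  ext w
  by_cases hw : 0 ≤ w <;> simp [exponentialPDF_eq, hw, Set.indicator]

variable {r τ : ℝ} {f g : ℝ → ℝ}

lemma setLIntegral_Iic_expMeasure (hr : 0 < r) (hτ : 0 ≤ τ) (hg : ContinuousOn g (Set.Icc 0 τ))
    (hg0 : ∀ w ∈ Set.Icc 0 τ, 0 ≤ g w) :
    ∫⁻ w in Set.Iic τ, ENNReal.ofReal (g w) ∂expMeasure r =
      ENNReal.ofReal (∫ w in 0..τ, r * Real.exp (-(r * w)) * g w) := by
  rw [expMeasure_eq_withDensity, restrict_withDensity measurableSet_Iic,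
    lintegral_withDensity_eq_lintegral_mul_non_measurable _ (by fun_prop) (by simp),
    Measure.restrict_restrict measurableSet_Iic, Set.Iic_inter_Ioi,
    intervalIntegral.integral_of_le hτ, ofReal_integral_eq_lintegral_ofReal]
  · refine lintegral_congr fun w => ?_
    rw [ENNReal.ofReal_mul (by positivity), Pi.mul_apply]
  · rw [← IntegrableOn, ← integrableOn_Icc_iff_integrableOn_Ioc]
    exact (ContinuousOn.mul (by fun_prop) hg).integrableOn_Icc
  · exact (ae_restrict_iff' measurableSet_Ioc).2 (ae_of_all _ fun w hw =>
      mul_nonneg (by positivity) (hg0 w (Set.Ioc_subset_Icc_self hw)))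

lemma eq_exp_mul_add_integral_of_hasDerivAt (hτ : 0 ≤ τ) (hg : ContinuousOn g (Set.Icc 0 τ))
    (hf : ∀ σ ∈ Set.Icc 0 τ, HasDerivAt f (r * (g σ - f σ)) σ) :
    f τ = Real.exp (-(r * τ)) * f 0 + ∫ w in 0..τ, r * Real.exp (-(r * w)) * g (τ - w) := by
  have hderiv : ∀ w ∈ Set.uIcc 0 τ, HasDerivAt (fun w => -(Real.exp (-(r * w)) * f (τ - w)))
      (r * Real.exp (-(r * w)) * g (τ - w)) w := by
    intro w hw
    rw [Set.uIcc_of_le hτ] at hw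
    have hexp : HasDerivAt (fun w => -(r * w)) (-r) w := by
      simpa using (hasDerivAt_id w).const_mul (-r)
    have hfw := (hf (τ - w) ⟨by linarith [hw.2], by linarith [hw.1]⟩).comp_const_sub τ w
    exact (hexp.exp.mul hfw).neg.congr_deriv (by ring)
  have hint : IntervalIntegrable (fun w => r * Real.exp (-(r * w)) * g (τ - w)) volume 0 τ := by
    refine ContinuousOn.intervalIntegrable ?_
    rw [Set.uIcc_of_le hτ]
    exact ContinuousOn.mul (by fun_prop) (hg.comp (by fun_prop) fun w hw =>
      ⟨by linarith [hw.2], by linarith [hw.1]⟩)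
  rw [intervalIntegral.integral_eq_sub_of_hasDerivAt hderiv hint]
  simp

/- Variation of constants in probabilistic form: `f` is the expected reward when an exponential
clock of rate `r` either outlives `τ`, or rings after `w` and pays `g (τ - w)`. -/
lemma lintegral_expMeasure_of_hasDerivAt (hr : 0 < r) (hτ : 0 ≤ τ) (hf0 : 0 ≤ f 0)
    (hg : ContinuousOn g (Set.Icc 0 τ)) (hg0 : ∀ σ ∈ Set.Icc 0 τ, 0 ≤ g σ)
    (hf : ∀ σ ∈ Set.Icc 0 τ, HasDerivAt f (r * (g σ - f σ)) σ) :
    ∫⁻ w, ENNReal.ofReal (if τ < w then f 0 else g (τ - w)) ∂expMeasure r =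
      ENNReal.ofReal (f τ) := by
  have hmem : ∀ w ∈ Set.Icc 0 τ, τ - w ∈ Set.Icc 0 τ := fun w hw =>
    ⟨by linarith [hw.2], by linarith [hw.1]⟩
  have hlate : ∫⁻ w in Set.Ioi τ, ENNReal.ofReal (if τ < w then f 0 else g (τ - w)) ∂expMeasure r =
      ENNReal.ofReal (Real.exp (-(r * τ)) * f 0) := by
    rw [setLIntegral_congr_fun measurableSet_Ioi (g := fun _ => ENNReal.ofReal (f 0))
      fun w hw => by simp only [if_pos (Set.mem_Ioi.1 hw)], setLIntegral_const,
      expMeasure_Ioi hr, max_eq_left hτ, mul_comm, ENNReal.ofReal_mul (Real.exp_pos _).le]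
  have hearly : ∫⁻ w in Set.Iic τ, ENNReal.ofReal (if τ < w then f 0 else g (τ - w))
      ∂expMeasure r = ENNReal.ofReal (∫ w in 0..τ, r * Real.exp (-(r * w)) * g (τ - w)) := by
    rw [← setLIntegral_Iic_expMeasure (g := fun w => g (τ - w)) hr hτ
      (hg.comp (by fun_prop) hmem) fun w hw => hg0 _ (hmem w hw)]
    exact setLIntegral_congr_fun measurableSet_Iic fun w hw => by
      simp only [if_neg (not_lt.2 (Set.mem_Iic.1 hw))]
  rw [← lintegral_add_compl _ measurableSet_Ioi, Set.compl_Ioi, hlate, hearly,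
    ← ENNReal.ofReal_add (mul_nonneg (Real.exp_pos _).le hf0)
      (intervalIntegral.integral_nonneg hτ fun w hw =>
        mul_nonneg (by positivity) (hg0 _ (hmem w hw))),
    ← eq_exp_mul_add_integral_of_hasDerivAt hτ hg hf]

end ExponentialLaw

section Tightness

lemma isTightMeasureSet_pi {ι : Type*} [Finite ι] {E : ι → Type*} [∀ i, TopologicalSpace (E i)]
    [∀ i, MeasurableSpace (E i)] {S : Set (Measure (∀ i, E i))}
    (hS : ∀ i, IsTightMeasureSet (Measure.map (Function.eval i) '' S)) : IsTightMeasureSet S := by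
  have := Fintype.ofFinite ι
  simp only [isTightMeasureSet_iff_exists_isCompact_measure_compl_le, Set.forall_mem_image] at hS ⊢
  intro ε hε
  choose K hK hKle using fun i =>
    hS i (ε / Fintype.card ι) (ENNReal.div_pos hε.ne' (ENNReal.natCast_ne_top _))
  refine ⟨Set.univ.pi K, isCompact_univ_pi hK, fun μ hμ => ?_⟩
  calc μ (Set.univ.pi K)ᶜ
      ≤ μ (⋃ i, Function.eval i ⁻¹' (K i)ᶜ) := by
        refine measure_mono fun y hy => ?_
        simpa [Set.mem_pi] using hy
    _ ≤ ∑ i, μ (Function.eval i ⁻¹' (K i)ᶜ) := measure_iUnion_fintype_le _ _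
    _ ≤ ∑ _i : ι, ε / Fintype.card ι := Finset.sum_le_sum fun i _ =>
        (Measure.le_map_apply (measurable_pi_apply i).aemeasurable _).trans (hKle i hμ)
    _ ≤ ε := by
        rw [Finset.sum_const, Finset.card_univ, nsmul_eq_mul]
        exact ENNReal.mul_div_le

lemma isTightMeasureSet_range_map_of_mgf_le {Ω κ : Type*} [MeasurableSpace Ω] {P : Measure Ω}
    [IsFiniteMeasure P] {Y : κ → Ω → ℝ} (hY : ∀ t, AEMeasurable (Y t) P)
    (hY₀ : ∀ t, ∀ᵐ ω ∂P, 0 ≤ Y t ω) {s C : ℝ} (hs : 0 < s)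
    (hint : ∀ t, Integrable (fun ω => Real.exp (s * Y t ω)) P) (hC : ∀ t, mgf (Y t) P s ≤ C) :
    IsTightMeasureSet (Set.range fun t => P.map (Y t)) := by
  have hlim : Tendsto (fun R => ENNReal.ofReal (Real.exp (-s * R) * C)) atTop (𝓝 0) := by
    have hexp : Tendsto (fun R => Real.exp (-s * R)) atTop (𝓝 0) :=
      Real.tendsto_exp_atBot.comp (tendsto_id.const_mul_atTop_of_neg (neg_neg_of_pos hs))
    simpa using ENNReal.tendsto_ofReal (hexp.mul_const C)
  rw [isTightMeasureSet_iff_exists_isCompact_measure_compl_le]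
  intro ε hε
  obtain ⟨R, hR⟩ := (hlim.eventually (ge_mem_nhds hε)).exists
  refine ⟨Set.Icc 0 R, isCompact_Icc, Set.forall_mem_range.2 fun t => ?_⟩
  calc P.map (Y t) (Set.Icc 0 R)ᶜ
      ≤ P {ω | R ≤ Y t ω} := by
        rw [Measure.map_apply_of_aemeasurable (hY t) measurableSet_Icc.compl]
        refine measure_mono_ae ?_
        filter_upwards [hY₀ t] with ω hω hωR
        exact not_lt.1 fun hlt => hωR ⟨hω, hlt.le⟩
    _ ≤ ENNReal.ofReal (Real.exp (-s * R) * C) := by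
        rw [← ofReal_measureReal]
        refine ENNReal.ofReal_le_ofReal ((measure_ge_le_exp_mul_mgf R hs.le (hint t)).trans ?_)
        gcongr
        exact hC t
    _ ≤ ε := hR

end Tightness

section Laplace

open scoped BoundedContinuousFunction

variable {ι : Type*} [Fintype ι]

/-- The function `y ↦ exp (-∑ i, s i * y i)`, which is bounded on the nonnegative orthant. -/
noncomputable def expNegSum (s : ι → ℝ≥0) : (ι → ℝ≥0) →ᵇ ℝ :=
  BoundedContinuousFunction.ofNormedAddCommGroup
    (fun y => Real.exp (-∑ i, (s i : ℝ) * y i)) (by fun_prop) 1 fun y => by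
      rw [Real.norm_eq_abs, Real.abs_exp, Real.exp_le_one_iff, neg_nonpos]
      positivity

lemma expNegSum_apply (s y : ι → ℝ≥0) : expNegSum s y = Real.exp (-∑ i, (s i : ℝ) * y i) := rfl

lemma expNegSum_add (s s' : ι → ℝ≥0) : expNegSum (s + s') = expNegSum s * expNegSum s' := by
  ext y
  simp only [BoundedContinuousFunction.mul_apply, expNegSum_apply, ← Real.exp_add, Pi.add_apply,
    NNReal.coe_add, add_mul, Finset.sum_add_distrib, neg_add]

lemma expNegSum_zero : expNegSum (0 : ι → ℝ≥0) = 1 := by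
  ext y
  simp [expNegSum_apply]

/-- The algebra generated by the functions `y ↦ exp (-∑ i, s i * y i)` on the nonnegative orthant,
to which the Stone–Weierstrass argument applies. -/
noncomputable def expNegSumAlgebra (ι : Type*) [Fintype ι] :
    StarSubalgebra ℝ ((ι → ℝ≥0) →ᵇ ℝ) where
  toSubalgebra := Algebra.adjoin ℝ (Set.range expNegSum)
  star_mem' := fun {a} ha => by
    have : star a = a := by ext; simp
    rwa [this]

lemma separatesPoints_expNegSumAlgebra : ((expNegSumAlgebra ι).map
    (BoundedContinuousFunction.toContinuousMapStarₐ ℝ)).SeparatesPoints := by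
  classical
  intro y z hyz
  obtain ⟨i, hi⟩ := Function.ne_iff.1 hyz
  have hsum : ∀ y : ι → ℝ≥0, ∑ k, ((Pi.single i 1 : ι → ℝ≥0) k : ℝ) * y k = y i := fun y => by
    rw [Finset.sum_eq_single i] <;> simp +contextual
  refine ⟨expNegSum (Pi.single i 1), ⟨_, ⟨_, Algebra.subset_adjoin ⟨Pi.single i 1, rfl⟩, rfl⟩, rfl⟩,
    ?_⟩
  rw [expNegSum_apply, expNegSum_apply, hsum, hsum, Ne, Real.exp_eq_exp, neg_inj, NNReal.coe_inj]
  exact hi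

lemma mem_span_of_mem_expNegSumAlgebra {g : (ι → ℝ≥0) →ᵇ ℝ} (hg : g ∈ expNegSumAlgebra ι) :
    g ∈ Submodule.span ℝ (Set.range (expNegSum (ι := ι))) := by
  have hclosure : ∀ f ∈ Submonoid.closure (Set.range (expNegSum (ι := ι))),
      f ∈ Set.range (expNegSum (ι := ι)) := by
    intro f hf
    induction hf using Submonoid.closure_induction with
    | mem _ hf => exact hf
    | one => exact ⟨0, expNegSum_zero⟩
    | mul f g _ _ hf hg =>
      obtain ⟨s, rfl⟩ := hf
      obtain ⟨s', rfl⟩ := hg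
      exact ⟨s + s', expNegSum_add s s'⟩
  replace hg : g ∈ Subalgebra.toSubmodule (Algebra.adjoin ℝ (Set.range (expNegSum (ι := ι)))) := hg
  rw [Algebra.adjoin_eq_span] at hg
  exact Submodule.span_mono hclosure hg

lemma tendsto_of_tendsto_integral_expNegSum {κ : Type*} {l : Filter κ}
    {μ : κ → ProbabilityMeasure (ι → ℝ≥0)} {μ₀ : ProbabilityMeasure (ι → ℝ≥0)}
    (hμ : IsTightMeasureSet {(μ t : Measure (ι → ℝ≥0)) | t})
    (h : ∀ s : ι → ℝ≥0, Tendsto (fun t => ∫ y, expNegSum s y ∂(μ t)) l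
      (𝓝 (∫ y, expNegSum s y ∂μ₀))) :
    Tendsto μ l (𝓝 μ₀) := by
  refine ProbabilityMeasure.tendsto_of_tight_of_separatesPoints ℝ hμ
    separatesPoints_expNegSumAlgebra fun g hg => ?_
  replace hg := mem_span_of_mem_expNegSumAlgebra hg
  induction hg using Submodule.span_induction with
  | mem f hf =>
    obtain ⟨s, rfl⟩ := hf
    exact h s
  | zero => simpa using tendsto_const_nhds
  | add f g _ _ ihf ihg =>
    simp only [BoundedContinuousFunction.add_apply]
    simp_rw [integral_add (BoundedContinuousFunction.integrable _ f)
      (BoundedContinuousFunction.integrable _ g)]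
    exact ihf.add ihg
  | smul a _ _ ihf =>
    simp only [BoundedContinuousFunction.smul_apply, smul_eq_mul, integral_const_mul]
    exact ihf.const_mul a

lemma integral_expNegSum_map_toNNReal {Ω : Type*} [MeasurableSpace Ω] {P : Measure Ω}
    {V : Ω → ι → ℝ} (hV : AEMeasurable V P) (hV₀ : ∀ᵐ ω ∂P, 0 ≤ V ω) (s : ι → ℝ≥0) :
    ∫ y, expNegSum s y ∂P.map (fun ω i => (V ω i).toNNReal) =
      ∫ ω, Real.exp (∑ i, -(s i : ℝ) * V ω i) ∂P := by
  rw [integral_map (by fun_prop) (expNegSum s).continuous.aestronglyMeasurable]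
  refine integral_congr_ae ?_
  filter_upwards [hV₀] with ω hω
  simp only [expNegSum_apply, Real.coe_toNNReal _ (hω _), neg_mul, Finset.sum_neg_distrib]

lemma tendstoInDistribution_of_tendsto_integral_exp {Ω Ω' κ : Type*} [MeasurableSpace Ω]
    [MeasurableSpace Ω'] {P : Measure Ω} {P' : Measure Ω'} [IsProbabilityMeasure P]
    [IsProbabilityMeasure P'] {l : Filter κ} {Y : κ → Ω → ι → ℝ} {Z : Ω' → ι → ℝ}
    (hY : ∀ t, AEMeasurable (Y t) P) (hZ : AEMeasurable Z P') (hY₀ : ∀ t, ∀ᵐ ω ∂P, 0 ≤ Y t ω)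
    (hZ₀ : ∀ᵐ ω ∂P', 0 ≤ Z ω) (htight : IsTightMeasureSet (Set.range fun t => P.map (Y t)))
    (h : ∀ s : ι → ℝ, s ≤ 0 → Tendsto (fun t => ∫ ω, Real.exp (∑ i, s i * Y t ω i) ∂P) l
      (𝓝 (∫ ω, Real.exp (∑ i, s i * Z ω i) ∂P'))) :
    TendstoInDistribution Y l Z (fun _ => P) P' := by
  have hto : Continuous fun (y : ι → ℝ) i => (y i).toNNReal := by fun_prop
  have hcoe : ∀ y : ι → ℝ, 0 ≤ y → (fun i => ((y i).toNNReal : ℝ)) = y := fun y hy =>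
    funext fun i => Real.coe_toNNReal _ (hy i)
  have htight' : IsTightMeasureSet
      (Set.range fun t => P.map fun ω i => (Y t ω i).toNNReal) := by
    refine (htight.map hto).subset (Set.range_subset_iff.2 fun t => ⟨_, ⟨t, rfl⟩, ?_⟩)
    exact AEMeasurable.map_map_of_aemeasurable hto.aemeasurable (hY t)
  have horthant : TendstoInDistribution (fun t ω i => (Y t ω i).toNNReal) l
      (fun ω i => (Z ω i).toNNReal) (fun _ => P) P' := by
    refine ⟨fun t => by fun_prop, by fun_prop,
      tendsto_of_tendsto_integral_expNegSum htight' fun s => ?_⟩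
    simp only [ProbabilityMeasure.coe_mk, integral_expNegSum_map_toNNReal hZ hZ₀,
      integral_expNegSum_map_toNNReal (hY _) (hY₀ _)]
    exact h (fun i => -s i) fun i => neg_nonpos.2 (s i).2
  refine (horthant.continuous_comp (g := fun (y : ι → ℝ≥0) i => (y i : ℝ)) (by fun_prop)).congr
    (fun t => ?_) ?_
  · filter_upwards [hY₀ t] with ω hω using hcoe _ hω
  · filter_upwards [hZ₀] with ω hω using hcoe _ hω

end Laplace

section Gamma

lemma ae_nonneg_gammaLaw (k θ : ℝ) : ∀ᵐ y ∂gammaLaw k θ, 0 ≤ y := by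
  unfold gammaLaw
  split_ifs with h
  · have hneg : gammaMeasure k θ⁻¹ (Set.Iio 0) = 0 := by
      rw [gammaMeasure, withDensity_apply _ measurableSet_Iio, lintegral_gammaPDF_of_nonpos le_rfl]
    exact (measure_eq_zero_iff_ae_notMem.1 hneg).mono fun y hy => not_lt.1 hy
  · simp [ae_dirac_eq]

lemma mgf_gammaMeasure {k r s : ℝ} (hk : 0 < k) (hr : 0 < r) (hs : s < r) :
    mgf id (gammaMeasure k r) s = (1 - s / r) ^ (-k) := by
  have hrs : 0 < r - s := sub_pos.2 hs
  have hdensity : ∀ y, (gammaPDF k r y).toReal • Real.exp (s * id y) =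
      (Set.Ici 0).indicator (fun y => r ^ k / Real.Gamma k *
        (y ^ (k - 1) * Real.exp (-((r - s) * y)))) y := by
    intro y
    rw [gammaPDF, ENNReal.toReal_ofReal (gammaPDFReal_nonneg hk hr y), gammaPDFReal, smul_eq_mul,
      Set.indicator_apply]
    by_cases hy : 0 ≤ y
    · rw [if_pos hy, if_pos (Set.mem_Ici.2 hy), mul_assoc, mul_assoc, ← Real.exp_add, id]
      ring_nf
    · rw [if_neg hy, if_neg (mt Set.mem_Ici.1 hy), zero_mul]
  have hbase : 1 - s / r = (r - s) / r := by field_simp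
  have hG := (Real.Gamma_pos_of_pos hk).ne'
  rw [mgf, gammaMeasure, integral_withDensity_eq_integral_toReal_smul (f := gammaPDF k r)
    (measurable_gammaPDFReal _ _).ennreal_ofReal (by simp [gammaPDF])]
  simp_rw [hdensity]
  rw [integral_indicator measurableSet_Ici, integral_Ici_eq_integral_Ioi, integral_const_mul,
    Real.integral_rpow_mul_exp_neg_mul_Ioi hk hrs, hbase, Real.rpow_neg (div_pos hrs hr).le,
    Real.div_rpow hrs.le hr.le, Real.div_rpow zero_le_one hrs.le, Real.one_rpow, inv_div]
  field_simp

lemma mgf_gammaLaw {k θ s : ℝ} (hk : 0 ≤ k) (hθ : 0 < θ) (hs : θ * s < 1) :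
    mgf id (gammaLaw k θ) s = (1 - θ * s) ^ (-k) := by
  unfold gammaLaw
  rcases hk.eq_or_lt with rfl | hk
  · simp [mgf]
  · have hs' : s < θ⁻¹ := by rwa [← one_div, lt_div_iff₀' hθ]
    rw [if_pos ⟨hk, hθ⟩, mgf_gammaMeasure hk (inv_pos.2 hθ) hs', div_inv_eq_mul, mul_comm]

end Gamma

section Product

variable {ι : Type*} [Fintype ι] {ν : ι → Measure ℝ} [∀ i, IsProbabilityMeasure (ν i)]

lemma integral_exp_sum_pi (s : ι → ℝ) :
    ∫ y, Real.exp (∑ i, s i * y i) ∂Measure.pi ν = ∏ i, mgf id (ν i) (s i) := by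
  simp_rw [Real.exp_sum]
  exact integral_fintype_prod_eq_prod fun i y => Real.exp (s i * y)

lemma ae_nonneg_pi (hν : ∀ i, ∀ᵐ y ∂ν i, 0 ≤ y) : ∀ᵐ y ∂Measure.pi ν, 0 ≤ y :=
  ae_all_iff.2 fun i => (measurePreserving_eval ν i).quasiMeasurePreserving.ae (hν i)

lemma tendstoInDistribution_eval_of_pi {Ω κ : Type*} [MeasurableSpace Ω] {P : Measure Ω}
    [IsProbabilityMeasure P] {l : Filter κ} {Y : κ → Ω → ι → ℝ}
    (h : TendstoInDistribution Y l (id : (ι → ℝ) → ι → ℝ) (fun _ => P) (Measure.pi ν)) (i : ι) :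
    TendstoInDistribution (fun t ω => Y t ω i) l (id : ℝ → ℝ) (fun _ => P) (ν i) := by
  have heval := h.continuous_comp (continuous_apply i)
  refine ⟨heval.forall_aemeasurable, aemeasurable_id, ?_⟩
  convert! heval.tendsto using 2
  refine congrArg 𝓝 (Subtype.ext ?_)
  change (ν i).map id = (Measure.pi ν).map (Function.eval i)
  rw [Measure.map_id, (measurePreserving_eval ν i).map_eq]

end Product

lemma lintegral_eq_sum_setLIntegral_fiber {Ω κ : Type*} [MeasurableSpace Ω] {P : Measure Ω}
    [Fintype κ] [MeasurableSpace κ] [MeasurableSingletonClass κ] {f : Ω → κ} (hf : Measurable f)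
    (F : Ω → ENNReal) : ∫⁻ ω, F ω ∂P = ∑ k, ∫⁻ ω in f ⁻¹' {k}, F ω ∂P := by
  rw [← setLIntegral_univ, ← Set.preimage_univ (f := f), ← Set.iUnion_of_singleton κ,
    Set.preimage_iUnion, lintegral_iUnion (fun k => hf (measurableSet_singleton k))
      (pairwise_disjoint_fiber f), tsum_fintype]

lemma setLIntegral_eq_sum_setLIntegral_inter_fiber {Ω κ : Type*} [MeasurableSpace Ω]
    {P : Measure Ω} [Fintype κ] [MeasurableSpace κ] [MeasurableSingletonClass κ] {f : Ω → κ}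
    (hf : Measurable f) (B : Set Ω) (F : Ω → ENNReal) :
    ∫⁻ ω in B, F ω ∂P = ∑ k, ∫⁻ ω in B ∩ f ⁻¹' {k}, F ω ∂P := by
  rw [lintegral_eq_sum_setLIntegral_fiber hf]
  refine Finset.sum_congr rfl fun k _ => ?_
  rw [Measure.restrict_restrict (hf (measurableSet_singleton k)), Set.inter_comm]

lemma sum_ofReal_div_sum {ι : Type*} [Fintype ι] {y : ι → ℝ} (hy : 0 < y) :
    ∑ i, ENNReal.ofReal (y i / ∑ j, y j) = 1 := by
  rw [← ENNReal.ofReal_sum_of_nonneg fun i _ => div_nonneg (hy.le i) (Fintype.sum_pos hy).le,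
    ← Finset.sum_div, div_self (Fintype.sum_pos hy).ne', ENNReal.ofReal_one]

section Walk

variable {Ω : Type*} {c : ℕ} {A : Matrix (Fin c) (Fin c) ℝ} {x : Fin c → ℝ} {W : ℕ → Ω → ℝ}
  {I : ℕ → Ω → Fin c}

/-- Tenability of the navigation matrix `A` from the starting point `x`: whatever the successive
renewal types, the walk keeps nonnegative coordinates and avoids the origin. -/
def IsTenable (A : Matrix (Fin c) (Fin c) ℝ) (x : Fin c → ℝ) : Prop :=
  ∀ (I : ℕ → Fin c) (n : ℕ), 0 < x + ∑ k ∈ Finset.range n, A.row (I k)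

/-- The event that exactly `n` renewals have occurred by time `t`, so that the walk sits at its
`n`-th position. -/
def sojourn (W : ℕ → Ω → ℝ) (t : ℝ) (n : ℕ) : Set Ω :=
  {ω | renewalEpoch W n ω ≤ t ∧ t < renewalEpoch W (n + 1) ω}

lemma IsTenable.polyaPosition_pos (hA : IsTenable A x) (I : ℕ → Ω → Fin c) (n : ℕ) (ω : Ω) :
    0 < polyaPosition A x I n ω :=
  hA (fun k => I k ω) n

lemma polyaPosition_zero (A : Matrix (Fin c) (Fin c) ℝ) (x : Fin c → ℝ) (I : ℕ → Ω → Fin c)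
    (ω : Ω) : polyaPosition A x I 0 ω = x := by
  simp [polyaPosition]

lemma polyaPosition_succ (A : Matrix (Fin c) (Fin c) ℝ) (x : Fin c → ℝ) (I : ℕ → Ω → Fin c)
    (n : ℕ) (ω : Ω) :
    polyaPosition A x I (n + 1) ω = polyaPosition A x I n ω + A.row (I n ω) := by
  simp only [polyaPosition, Finset.sum_range_succ, add_assoc]

lemma renewalEpoch_zero (W : ℕ → Ω → ℝ) (ω : Ω) : renewalEpoch W 0 ω = 0 := by
  simp [renewalEpoch]

lemma renewalEpoch_succ (W : ℕ → Ω → ℝ) (n : ℕ) (ω : Ω) :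
    renewalEpoch W (n + 1) ω = renewalEpoch W n ω + W n ω :=
  Finset.sum_range_succ _ _

lemma measurable_renewalHistory_renewalEpoch (n : ℕ) :
    Measurable[renewalHistory W I n] (renewalEpoch W n) := by
  have hfactor : renewalEpoch W n = (fun p : Fin n → ℝ × Fin c => ∑ k, (p k).1) ∘
      fun ω (k : Fin n) => (W k ω, I k ω) := by
    ext ω
    simp [renewalEpoch, Fin.sum_univ_eq_sum_range (fun k => W k ω)]
  rw [hfactor]
  exact Measurable.comp (by fun_prop) (comap_measurable _)

lemma measurable_renewalHistory_types (n : ℕ) :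
    Measurable[renewalHistory W I n] fun ω (k : Fin n) => I k ω :=
  Measurable.comp (g := fun (p : Fin n → ℝ × Fin c) k => (p k).2) (by fun_prop)
    (comap_measurable _)

lemma polyaPosition_eq_types (n : ℕ) :
    polyaPosition A x I n =
      (fun j : Fin n → Fin c => x + ∑ k, A.row (j k)) ∘ fun ω (k : Fin n) => I k ω := by
  ext1 ω
  simp only [polyaPosition, Function.comp_apply, Fin.sum_univ_eq_sum_range (fun k => A.row (I k ω))]

lemma measurable_renewalHistory_polyaPosition (n : ℕ) :
    Measurable[renewalHistory W I n] (polyaPosition A x I n) := by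
  rw [polyaPosition_eq_types]
  exact (measurable_of_countable _).comp (measurable_renewalHistory_types n)

end Walk

namespace IsDrivenBy

variable {Ω : Type*} [MeasurableSpace Ω] {c : ℕ} {P : Measure Ω}
  {A : Matrix (Fin c) (Fin c) ℝ} {x : Fin c → ℝ} {X : ℝ≥0 → Ω → Fin c → ℝ} {W : ℕ → Ω → ℝ}
  {I : ℕ → Ω → Fin c} {n : ℕ}

lemma renewalHistory_le (h : IsDrivenBy P A x X W I) (n : ℕ) :
    renewalHistory W I n ≤ ‹MeasurableSpace Ω› :=
  Measurable.comap_le (measurable_pi_lambda _ fun k =>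
    (h.measurable_wait k).prodMk (h.measurable_type k))

lemma measurable_renewalEpoch (h : IsDrivenBy P A x X W I) (n : ℕ) :
    Measurable (renewalEpoch W n) :=
  (measurable_renewalHistory_renewalEpoch n).mono (h.renewalHistory_le n) le_rfl

lemma measurable_polyaPosition (h : IsDrivenBy P A x X W I) (n : ℕ) :
    Measurable (polyaPosition A x I n) :=
  (measurable_renewalHistory_polyaPosition n).mono (h.renewalHistory_le n) le_rfl

lemma measurableSet_sojourn (h : IsDrivenBy P A x X W I) (t : ℝ) (n : ℕ) :
    MeasurableSet (sojourn W t n) :=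
  (measurableSet_le (h.measurable_renewalEpoch n) measurable_const).inter
    (measurableSet_lt measurable_const (h.measurable_renewalEpoch (n + 1)))

/- The history splits into finitely many pieces on which the position is constant. -/
lemma lintegral_congr_of_renewalHistory (h : IsDrivenBy P A x X W I) {F G : Ω → ENNReal}
    (hFG : ∀ B, MeasurableSet[renewalHistory W I n] B →
      ∀ ω₀ ∈ B, (∀ ω ∈ B, polyaPosition A x I n ω = polyaPosition A x I n ω₀) →
        ∫⁻ ω in B, F ω ∂P = ∫⁻ ω in B, G ω ∂P) :
    ∫⁻ ω, F ω ∂P = ∫⁻ ω, G ω ∂P := by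
  have htypes : Measurable fun ω (k : Fin n) => I k ω :=
    (measurable_renewalHistory_types n).mono (h.renewalHistory_le n) le_rfl
  rw [lintegral_eq_sum_setLIntegral_fiber htypes F, lintegral_eq_sum_setLIntegral_fiber htypes G]
  refine Finset.sum_congr rfl fun j _ => ?_
  rcases ((fun ω (k : Fin n) => I k ω) ⁻¹' {j}).eq_empty_or_nonempty with hempty | ⟨ω₀, hω₀⟩
  · simp [hempty]
  · refine hFG _ (measurable_renewalHistory_types n (measurableSet_singleton j)) ω₀ hω₀
      fun ω hω => ?_
    rw [polyaPosition_eq_types]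
    exact congrArg (fun j : Fin n → Fin c => x + ∑ k, A.row (j k)) (hω.trans hω₀.symm)

section Markov

variable [IsProbabilityMeasure P] {B : Set Ω} {y : Fin c → ℝ}

lemma measure_inter_wait_type (h : IsDrivenBy P A x X W I)
    (hB : MeasurableSet[renewalHistory W I n] B) (hBy : ∀ ω ∈ B, polyaPosition A x I n ω = y)
    (i : Fin c) {w : ℝ} (hw : 0 ≤ w) :
    P (B ∩ {ω | w < W n ω ∧ I n ω = i}) =
      P B * ENNReal.ofReal (Real.exp (-(w * ∑ j, y j)) * (y i / ∑ j, y j)) := by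
  have hm : MeasurableSet {ω | w < W n ω ∧ I n ω = i} :=
    (measurableSet_lt measurable_const (h.measurable_wait n)).inter
      (h.measurable_type n (measurableSet_singleton i))
  have hle := h.renewalHistory_le n
  have hreal : P.real (B ∩ {ω | w < W n ω ∧ I n ω = i}) =
      P.real B * (Real.exp (-(w * ∑ j, y j)) * (y i / ∑ j, y j)) :=
    calc P.real (B ∩ {ω | w < W n ω ∧ I n ω = i})
        = ∫ ω in B, (P⟦{ω | w < W n ω ∧ I n ω = i} | renewalHistory W I n⟧) ω ∂P := by
          rw [setIntegral_condExp hle ((integrable_const 1).indicator hm) hB,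
            integral_indicator hm, Measure.restrict_restrict hm, Set.inter_comm]
          simp
      _ = ∫ _ in B, Real.exp (-(w * ∑ j, y j)) * (y i / ∑ j, y j) ∂P := by
          refine setIntegral_congr_ae (hle _ hB) ?_
          filter_upwards [h.condProb_renewal n i w hw] with ω hω hωB
          rw [hω, hBy ω hωB]
      _ = _ := by simp
  rw [← ofReal_measureReal, hreal, ENNReal.ofReal_mul measureReal_nonneg, ofReal_measureReal]

lemma ae_wait_pos (h : IsDrivenBy P A x X W I) (hA : IsTenable A x) (n : ℕ) :
    ∀ᵐ ω ∂P, 0 < W n ω := by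
  have hm : MeasurableSet {ω | 0 < W n ω} :=
    measurableSet_lt measurable_const (h.measurable_wait n)
  refine (prob_compl_eq_zero_iff hm).2 ?_
  rw [← measure_univ (μ := P), ← lintegral_indicator_one hm, ← lintegral_one]
  refine h.lintegral_congr_of_renewalHistory (n := n) fun B hB ω₀ _ hBy => ?_
  calc ∫⁻ ω in B, {ω | 0 < W n ω}.indicator 1 ω ∂P
      = ∑ i, P (B ∩ {ω | 0 < W n ω ∧ I n ω = i}) := by
        rw [setLIntegral_eq_sum_setLIntegral_inter_fiber (h.measurable_type n)]
        refine Finset.sum_congr rfl fun i _ => ?_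
        rw [lintegral_indicator_one hm, Measure.restrict_apply hm]
        congr 1 with ω
        exact and_left_comm
    _ = ∫⁻ _ in B, 1 ∂P := by
        simp_rw [h.measure_inter_wait_type hB hBy _ le_rfl, zero_mul, neg_zero, Real.exp_zero,
          one_mul, ← Finset.mul_sum, sum_ofReal_div_sum (hA.polyaPosition_pos I n ω₀), mul_one,
          setLIntegral_one]

lemma ae_monotone_renewalEpoch (h : IsDrivenBy P A x X W I) (hA : IsTenable A x) :
    ∀ᵐ ω ∂P, Monotone fun n => renewalEpoch W n ω := by
  filter_upwards [ae_all_iff.2 (h.ae_wait_pos hA)] with ω hω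
  refine monotone_nat_of_le_succ fun n => ?_
  rw [renewalEpoch_succ]
  linarith [hω n]

lemma map_prodMk_wait (h : IsDrivenBy P A x X W I) (hA : IsTenable A x)
    (hB : MeasurableSet[renewalHistory W I n] B) (hBy : ∀ ω ∈ B, polyaPosition A x I n ω = y)
    (hy : 0 < ∑ j, y j) {E : Type*} [MeasurableSpace E] {Z : Ω → E}
    (hZ : Measurable[renewalHistory W I n] Z) (i : Fin c) :
    (P.restrict (B ∩ I n ⁻¹' {i})).map (fun ω => (Z ω, W n ω)) =
      (ENNReal.ofReal (y i / ∑ j, y j) • (P.restrict B).map Z).prod (expMeasure (∑ j, y j)) := by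
  have hZm : Measurable Z := hZ.mono (h.renewalHistory_le n) le_rfl
  have hZW := hZm.prodMk (h.measurable_wait n)
  have := isProbabilityMeasure_expMeasure hy
  set ν := ENNReal.ofReal (y i / ∑ j, y j) • (P.restrict B).map Z with hν
  have : IsFiniteMeasure ν := Measure.smul_finite _ ENNReal.ofReal_ne_top
  symm
  refine Measure.prod_eq_generateFrom (C := {s | MeasurableSet s}) (D := Set.range Set.Ioi)
    MeasurableSpace.generateFrom_measurableSet ?_ MeasurableSpace.isPiSystem_measurableSet
    isPiSystem_Ioi ν.toFiniteSpanningSetsIn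
    { set := fun n => Set.Ioi (-n : ℝ)
      set_mem := fun n => ⟨_, rfl⟩
      finite := fun n => measure_lt_top _ _
      spanning := ?_ } ?_
  · rw [← borel_eq_generateFrom_Ioi ℝ, BorelSpace.measurable_eq (α := ℝ)]
  · refine Set.eq_univ_of_forall fun w => ?_
    obtain ⟨k, hk⟩ := exists_nat_gt (-w)
    exact Set.mem_iUnion.2 ⟨k, neg_lt.1 hk⟩
  · rintro s (hs : MeasurableSet s) _ ⟨w, rfl⟩
    have hsB := h.measure_inter_wait_type ((hZ hs).inter hB) (fun ω hω => hBy ω hω.2) i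
      (le_max_right w 0)
    rw [ENNReal.ofReal_mul (Real.exp_pos _).le, mul_comm (max w 0)] at hsB
    rw [Measure.map_apply hZW (hs.prod measurableSet_Ioi),
      Measure.restrict_apply (hZW (hs.prod measurableSet_Ioi)), expMeasure_Ioi hy, hν,
      Measure.smul_apply, Measure.map_apply hZm hs, Measure.restrict_apply (hZm hs), smul_eq_mul,
      mul_right_comm, mul_comm, mul_comm (ENNReal.ofReal (y i / _)), ← hsB]
    refine measure_congr ?_
    filter_upwards [h.ae_wait_pos hA n] with ω hω
    refine propext ?_
    change ((Z ω ∈ s ∧ w < W n ω) ∧ ω ∈ B ∧ I n ω = i) ↔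
      ((Z ω ∈ s ∧ ω ∈ B) ∧ max w 0 < W n ω ∧ I n ω = i)
    rw [max_lt_iff]
    tauto

lemma setLIntegral_inter_type (h : IsDrivenBy P A x X W I) (hA : IsTenable A x)
    (hB : MeasurableSet[renewalHistory W I n] B) (hBy : ∀ ω ∈ B, polyaPosition A x I n ω = y)
    (hy : 0 < ∑ j, y j) {E : Type*} [MeasurableSpace E] {Z : Ω → E}
    (hZ : Measurable[renewalHistory W I n] Z) {f : E × ℝ → ENNReal} (hf : Measurable f)
    (i : Fin c) :
    ∫⁻ ω in B ∩ I n ⁻¹' {i}, f (Z ω, W n ω) ∂P = ENNReal.ofReal (y i / ∑ j, y j) *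
      ∫⁻ ω in B, ∫⁻ w, f (Z ω, w) ∂expMeasure (∑ j, y j) ∂P := by
  have hZm : Measurable Z := hZ.mono (h.renewalHistory_le n) le_rfl
  have := isProbabilityMeasure_expMeasure hy
  rw [← lintegral_map hf (hZm.prodMk (h.measurable_wait n)), h.map_prodMk_wait hA hB hBy hy hZ,
    lintegral_prod _ hf.aemeasurable, lintegral_smul_measure,
    lintegral_map hf.lintegral_prod_right' hZm, smul_eq_mul]

lemma lintegral_next_renewal (h : IsDrivenBy P A x X W I) (hA : IsTenable A x) {E : Type*}
    [MeasurableSpace E] {Z : Ω → E} (hZ : Measurable[renewalHistory W I n] Z)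
    {f : Fin c → E × ℝ → ENNReal} (hf : ∀ i, Measurable (f i)) :
    ∫⁻ ω, f (I n ω) (Z ω, W n ω) ∂P =
      ∫⁻ ω, ∫⁻ w, ∑ i, ENNReal.ofReal
          (polyaPosition A x I n ω i / ∑ j, polyaPosition A x I n ω j) * f i (Z ω, w)
        ∂expMeasure (∑ j, polyaPosition A x I n ω j) ∂P := by
  have hZm : Measurable Z := hZ.mono (h.renewalHistory_le n) le_rfl
  refine h.lintegral_congr_of_renewalHistory (n := n) fun B hB ω₀ _ hBy => ?_
  have hBm := h.renewalHistory_le n _ hB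
  set y := polyaPosition A x I n ω₀
  have hy : 0 < ∑ j, y j := Fintype.sum_pos (hA.polyaPosition_pos I n ω₀)
  have := isProbabilityMeasure_expMeasure hy
  have hinner : ∀ i, Measurable fun ω => ∫⁻ w, f i (Z ω, w) ∂expMeasure (∑ j, y j) := fun i =>
    (hf i).lintegral_prod_right'.comp hZm
  calc ∫⁻ ω in B, f (I n ω) (Z ω, W n ω) ∂P
      = ∑ i, ∫⁻ ω in B ∩ I n ⁻¹' {i}, f i (Z ω, W n ω) ∂P := by
        rw [setLIntegral_eq_sum_setLIntegral_inter_fiber (h.measurable_type n)]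
        refine Finset.sum_congr rfl fun i _ => setLIntegral_congr_fun
          (hBm.inter (h.measurable_type n (measurableSet_singleton i))) fun ω hω => ?_
        rw [show I n ω = i from hω.2]
    _ = ∑ i, ENNReal.ofReal (y i / ∑ j, y j) *
          ∫⁻ ω in B, ∫⁻ w, f i (Z ω, w) ∂expMeasure (∑ j, y j) ∂P := by
        simp_rw [fun i => h.setLIntegral_inter_type hA hB hBy hy hZ (hf i) i]
    _ = ∫⁻ ω in B, ∑ i, ENNReal.ofReal (y i / ∑ j, y j) *
          ∫⁻ w, f i (Z ω, w) ∂expMeasure (∑ j, y j) ∂P := by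
        rw [lintegral_finsetSum _ fun i _ => (hinner i).const_mul _]
        exact Finset.sum_congr rfl fun i _ => (lintegral_const_mul _ (hinner i)).symm
    _ = _ := by
        refine setLIntegral_congr_fun hBm fun ω hω => ?_
        simp only [hBy ω hω]
        rw [lintegral_finsetSum _ fun i _ => (by fun_prop : Measurable _)]
        exact Finset.sum_congr rfl fun i _ => (lintegral_const_mul _ (by fun_prop)).symm

end Markov

end IsDrivenBy

section FirstRenewal

variable {Ω : Type*} [MeasurableSpace Ω] {c : ℕ} {P : Measure Ω} [IsProbabilityMeasure P]
  {A : Matrix (Fin c) (Fin c) ℝ} {x : Fin c → ℝ} {X : ℝ≥0 → Ω → Fin c → ℝ} {W : ℕ → Ω → ℝ}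
  {I : ℕ → Ω → Fin c} {t : ℝ} {g : (Fin c → ℝ) → ENNReal} {F : ℝ → (Fin c → ℝ) → ENNReal}

/-- The equation that the expectation `F τ y` of `g` at time `τ ≤ t`, for the walk started at `y`,
satisfies by conditioning on the first renewal: either it comes after `τ` and the walk is still at
`y`, or it comes after a time `w ≤ τ` with some type `i`, and the walk starts afresh. -/
def SolvesFirstRenewal (A : Matrix (Fin c) (Fin c) ℝ) (t : ℝ) (g : (Fin c → ℝ) → ENNReal)
    (F : ℝ → (Fin c → ℝ) → ENNReal) : Prop :=
  ∀ τ ∈ Set.Icc 0 t, ∀ y, 0 < y →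
    ∫⁻ w, ∑ i, ENNReal.ofReal (y i / ∑ j, y j) *
        (if τ < w then g y else F (τ - w) (y + A.row i)) ∂expMeasure (∑ j, y j) = F τ y

/-- The contribution to `F t x` of the paths with at least `n` renewals by time `t`, when `F` solves
the first-renewal equation. -/
noncomputable def renewalRemainder (P : Measure Ω) (A : Matrix (Fin c) (Fin c) ℝ) (x : Fin c → ℝ)
    (W : ℕ → Ω → ℝ) (I : ℕ → Ω → Fin c) (t : ℝ) (F : ℝ → (Fin c → ℝ) → ENNReal) (n : ℕ) : ENNReal :=
  ∫⁻ ω in {ω | renewalEpoch W n ω ≤ t},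
    F (t - renewalEpoch W n ω) (polyaPosition A x I n ω) ∂P

namespace IsDrivenBy

lemma ae_renewalEpoch_nonneg (h : IsDrivenBy P A x X W I) (hA : IsTenable A x) (n : ℕ) :
    ∀ᵐ ω ∂P, 0 ≤ renewalEpoch W n ω := by
  filter_upwards [h.ae_monotone_renewalEpoch hA] with ω hω
  simpa only [renewalEpoch_zero] using hω (Nat.zero_le n)

lemma renewalRemainder_eq_setLIntegral (h : IsDrivenBy P A x X W I) (hA : IsTenable A x)
    (hg : Measurable g) (hF : Measurable (Function.uncurry F)) (hsol : SolvesFirstRenewal A t g F)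
    (n : ℕ) :
    renewalRemainder P A x W I t F n =
      ∫⁻ ω in {ω | renewalEpoch W n ω ≤ t}, (if t - renewalEpoch W n ω < W n ω then
        g (polyaPosition A x I n ω) else
        F (t - renewalEpoch W n ω - W n ω) (polyaPosition A x I n ω + A.row (I n ω))) ∂P := by
  have hm : MeasurableSet {ω | renewalEpoch W n ω ≤ t} :=
    measurableSet_le (h.measurable_renewalEpoch n) measurable_const
  let f : Fin c → (ℝ × (Fin c → ℝ)) × ℝ → ENNReal := fun i p =>
    if p.1.1 ≤ t then
      if t - p.1.1 < p.2 then g p.1.2 else F (t - p.1.1 - p.2) (p.1.2 + A.row i)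
    else 0
  have hf : ∀ i, Measurable (f i) := fun i =>
    Measurable.ite (measurableSet_le (by fun_prop) measurable_const)
      (Measurable.ite (measurableSet_lt (by fun_prop) (by fun_prop)) (by fun_prop)
        (hF.comp (f := fun p : (ℝ × (Fin c → ℝ)) × ℝ => (t - p.1.1 - p.2, p.1.2 + A.row i))
          (by fun_prop))) measurable_const
  have hnext := h.lintegral_next_renewal hA
    ((measurable_renewalHistory_renewalEpoch n).prodMk
      (measurable_renewalHistory_polyaPosition (A := A) (x := x) n)) hf
  rw [renewalRemainder, ← lintegral_indicator hm, ← lintegral_indicator hm]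
  refine Eq.trans (lintegral_congr_ae ?_) hnext.symm
  filter_upwards [h.ae_renewalEpoch_nonneg hA n] with ω hω
  by_cases hωt : renewalEpoch W n ω ≤ t
  · simp only [f, Set.indicator, Set.mem_ofPred_eq, hωt, if_true]
    exact (hsol _ ⟨sub_nonneg.2 hωt, by linarith⟩ _ (hA.polyaPosition_pos I n ω)).symm
  · simp [f, Set.indicator, hωt]

lemma renewalRemainder_eq_add (h : IsDrivenBy P A x X W I) (hA : IsTenable A x)
    (hg : Measurable g) (hF : Measurable (Function.uncurry F)) (hsol : SolvesFirstRenewal A t g F)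
    (n : ℕ) :
    renewalRemainder P A x W I t F n =
      ∫⁻ ω in sojourn W t n, g (polyaPosition A x I n ω) ∂P +
        renewalRemainder P A x W I t F (n + 1) := by
  have hstay : sojourn W t n ⊆ {ω | renewalEpoch W n ω ≤ t} := fun ω hω => hω.1
  have hleave : ({ω | renewalEpoch W n ω ≤ t} \ sojourn W t n : Set Ω) =ᵐ[P]
      {ω | renewalEpoch W (n + 1) ω ≤ t} := by
    filter_upwards [h.ae_monotone_renewalEpoch hA] with ω hmono
    refine propext ⟨fun hω => not_lt.1 fun hlt => hω.2 ⟨hω.1, hlt⟩, fun hω => ?_⟩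
    exact ⟨(hmono n.le_succ).trans hω, fun hstay => hstay.2.not_ge hω⟩
  rw [h.renewalRemainder_eq_setLIntegral hA hg hF hsol,
    ← lintegral_inter_add_sdiff _ _ (h.measurableSet_sojourn t n), Set.inter_eq_right.2 hstay,
    setLIntegral_congr hleave, renewalRemainder]
  congr 1
  · refine setLIntegral_congr_fun (h.measurableSet_sojourn t n) fun ω hω => if_pos ?_
    rw [sub_lt_iff_lt_add', ← renewalEpoch_succ]
    exact hω.2
  · refine setLIntegral_congr_fun
      (measurableSet_le (h.measurable_renewalEpoch (n + 1)) measurable_const) fun ω hω => ?_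
    rw [polyaPosition_succ, sub_sub, ← renewalEpoch_succ, if_neg]
    rw [not_lt, le_sub_iff_add_le', ← renewalEpoch_succ]
    exact hω

lemma sum_setLIntegral_sojourn_add_renewalRemainder (h : IsDrivenBy P A x X W I)
    (hA : IsTenable A x) (ht : 0 ≤ t) (hg : Measurable g) (hF : Measurable (Function.uncurry F))
    (hsol : SolvesFirstRenewal A t g F) (n : ℕ) :
    ∑ k ∈ Finset.range n, ∫⁻ ω in sojourn W t k, g (polyaPosition A x I k ω) ∂P +
      renewalRemainder P A x W I t F n = F t x := by
  induction n with
  | zero => simp [renewalRemainder, renewalEpoch_zero, polyaPosition_zero, ht]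
  | succ n ih =>
    rw [Finset.sum_range_succ, add_assoc, ← h.renewalRemainder_eq_add hA hg hF hsol, ih]

lemma tsum_setLIntegral_sojourn (h : IsDrivenBy P A x X W I)
    (hA : IsTenable A x) (ht : 0 ≤ t) (hg : Measurable g) (hF : Measurable (Function.uncurry F))
    (hsol : SolvesFirstRenewal A t g F)
    (hrem : Tendsto (renewalRemainder P A x W I t F) atTop (𝓝 0)) :
    ∑' n, ∫⁻ ω in sojourn W t n, g (polyaPosition A x I n ω) ∂P = F t x := by
  have hlim := (ENNReal.tendsto_nat_tsum fun n =>
    ∫⁻ ω in sojourn W t n, g (polyaPosition A x I n ω) ∂P).add hrem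
  simp_rw [h.sum_setLIntegral_sojourn_add_renewalRemainder hA ht hg hF hsol, add_zero] at hlim
  exact tendsto_nhds_unique hlim tendsto_const_nhds

lemma pairwise_aedisjoint_sojourn (h : IsDrivenBy P A x X W I) (hA : IsTenable A x) (t : ℝ) :
    Pairwise (Function.onFun (AEDisjoint P) (sojourn W t)) := by
  have hlt : ∀ n m, n < m → AEDisjoint P (sojourn W t n) (sojourn W t m) := by
    intro n m hnm
    refine measure_eq_zero_iff_ae_notMem.2 ?_
    filter_upwards [h.ae_monotone_renewalEpoch hA] with ω hmono ⟨hn, hm⟩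
    exact (hn.2.trans_le (hmono hnm)).not_ge hm.1
  intro n m hnm
  rcases lt_or_gt_of_ne hnm with hlt' | hgt
  · exact hlt n m hlt'
  · exact (hlt m n hgt).symm

lemma ae_mem_iUnion_sojourn (h : IsDrivenBy P A x X W I) (hA : IsTenable A x) (ht : 0 ≤ t)
    (hF : Measurable (Function.uncurry F)) (hsol : SolvesFirstRenewal A t 1 F)
    (hrem : Tendsto (renewalRemainder P A x W I t F) atTop (𝓝 0)) (hFx : F t x = 1) :
    ∀ᵐ ω ∂P, ω ∈ ⋃ n, sojourn W t n := by
  have hsum := h.tsum_setLIntegral_sojourn hA ht measurable_one hF hsol hrem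
  simp only [Pi.one_apply, setLIntegral_one, hFx] at hsum
  rw [← measure_iUnion₀ (h.pairwise_aedisjoint_sojourn hA t)
    fun n => (h.measurableSet_sojourn t n).nullMeasurableSet] at hsum
  exact (prob_compl_eq_zero_iff (MeasurableSet.iUnion (h.measurableSet_sojourn t))).2 hsum

end IsDrivenBy

end FirstRenewal

namespace IsDrivenBy

variable {Ω : Type*} [MeasurableSpace Ω] {c : ℕ} {P : Measure Ω}
  {A : Matrix (Fin c) (Fin c) ℝ} {x : Fin c → ℝ} {X : ℝ≥0 → Ω → Fin c → ℝ} {W : ℕ → Ω → ℝ}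
  {I : ℕ → Ω → Fin c} {t : ℝ≥0}

lemma ae_exists_eq_polyaPosition (h : IsDrivenBy P A x X W I)
    (hfin : ∀ᵐ ω ∂P, ω ∈ ⋃ n, sojourn W t n) :
    ∀ᵐ ω ∂P, ∃ n, X t ω = polyaPosition A x I n ω := by
  filter_upwards [h.path_eq, hfin] with ω hpath hω
  obtain ⟨n, hn⟩ := Set.mem_iUnion.1 hω
  exact ⟨n, hpath n t hn.1 hn.2⟩

lemma aemeasurable (h : IsDrivenBy P A x X W I) (hfin : ∀ᵐ ω ∂P, ω ∈ ⋃ n, sojourn W t n) :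
    AEMeasurable (X t) P := by
  rw [← Measure.restrict_eq_self_of_ae_mem hfin, aemeasurable_iUnion_iff]
  refine fun n => (h.measurable_polyaPosition n).aemeasurable.congr ?_
  refine (ae_restrict_iff' (h.measurableSet_sojourn t n)).2 ?_
  filter_upwards [h.path_eq] with ω hpath hω
  exact (hpath n t hω.1 hω.2).symm

lemma lintegral_comp_eq_tsum [IsProbabilityMeasure P] (h : IsDrivenBy P A x X W I)
    (hA : IsTenable A x) (hfin : ∀ᵐ ω ∂P, ω ∈ ⋃ n, sojourn W t n) (g : (Fin c → ℝ) → ENNReal) :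
    ∫⁻ ω, g (X t ω) ∂P = ∑' n, ∫⁻ ω in sojourn W t n, g (polyaPosition A x I n ω) ∂P := by
  nth_rewrite 1 [← Measure.restrict_eq_self_of_ae_mem hfin]
  rw [lintegral_iUnion₀ (fun n => (h.measurableSet_sojourn t n).nullMeasurableSet)
    (h.pairwise_aedisjoint_sojourn hA t)]
  refine tsum_congr fun n => setLIntegral_congr_fun_ae (h.measurableSet_sojourn t n) ?_
  filter_upwards [h.path_eq] with ω hpath hω
  rw [hpath n t hω.1 hω.2]

end IsDrivenBy

/-- The base `1 - e^{aτ} (1 - e^{-au})` of the moment generating function at `u` of a single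
coordinate with increment `a`: after a time `τ` from the position `y`, that function is
`mgfBase a u τ ^ (-(y / a))`. -/
noncomputable def mgfBase (a u τ : ℝ) : ℝ :=
  1 - Real.exp (a * τ) * (1 - Real.exp (-(a * u)))

section mgfBase

variable {a u u' σ τ : ℝ}

lemma mgfBase_zero_right (a u : ℝ) : mgfBase a u 0 = Real.exp (-(a * u)) := by
  simp [mgfBase]

lemma mgfBase_zero_left (a τ : ℝ) : mgfBase a 0 τ = 1 := by
  simp [mgfBase]

lemma mgfBase_pos_of_le (ha : 0 ≤ a) (hστ : σ ≤ τ) (h : 0 < mgfBase a u τ) :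
    0 < mgfBase a u σ := by
  have hexp : Real.exp (a * σ) ≤ Real.exp (a * τ) := by gcongr
  unfold mgfBase at *
  rcases le_total (1 - Real.exp (-(a * u))) 0 with hneg | hnonneg
  · nlinarith [mul_nonneg (Real.exp_pos (a * σ)).le (neg_nonneg.2 hneg)]
  · nlinarith [mul_le_mul_of_nonneg_right hexp hnonneg]

lemma mgfBase_le_exp_mul (ha : 0 ≤ a) (hτ : 0 ≤ τ) (hu : u ≤ u') :
    mgfBase a u' τ ≤ Real.exp (-(a * (u' - u))) * mgfBase a u τ := by
  have hstart : 1 ≤ Real.exp (a * τ) := Real.one_le_exp (mul_nonneg ha hτ)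
  have hfactor : Real.exp (-(a * (u' - u))) ≤ 1 :=
    Real.exp_le_one_iff.2 (neg_nonpos.2 (mul_nonneg ha (sub_nonneg.2 hu)))
  have hsplit : Real.exp (-(a * u')) = Real.exp (-(a * (u' - u))) * Real.exp (-(a * u)) := by
    rw [← Real.exp_add]
    ring_nf
  rw [mgfBase, mgfBase, hsplit]
  linarith [mul_nonneg (sub_nonneg.2 hfactor) (sub_nonneg.2 hstart)]

lemma mgfBase_rpow_le (ha : 0 < a) (hτ : 0 ≤ τ) (hu : u ≤ u') (h : 0 < mgfBase a u' τ) {y : ℝ}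
    (hy : 0 ≤ y) :
    mgfBase a u τ ^ (-(y / a)) ≤ Real.exp (-((u' - u) * y)) * mgfBase a u' τ ^ (-(y / a)) := by
  have hle := mgfBase_le_exp_mul ha.le hτ hu
  have hpos : 0 < mgfBase a u τ := pos_of_mul_pos_right (h.trans_le hle) (Real.exp_pos _).le
  have hpow := Real.rpow_le_rpow_of_nonpos h hle (neg_nonpos.2 (div_nonneg hy ha.le))
  rw [Real.mul_rpow (Real.exp_pos _).le hpos.le, ← Real.exp_mul] at hpow
  calc mgfBase a u τ ^ (-(y / a))
      = Real.exp (-((u' - u) * y)) *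
          (Real.exp (-(a * (u' - u)) * -(y / a)) * mgfBase a u τ ^ (-(y / a))) := by
        rw [← mul_assoc, ← Real.exp_add]
        field_simp
        simp
    _ ≤ _ := by gcongr

lemma hasDerivAt_mgfBase (a u τ : ℝ) :
    HasDerivAt (mgfBase a u) (-(a * (1 - mgfBase a u τ))) τ := by
  have hlin : HasDerivAt (fun τ => a * τ) a τ := by simpa using (hasDerivAt_id τ).const_mul a
  exact ((hlin.exp.mul_const (1 - Real.exp (-(a * u)))).const_sub 1).congr_deriv
    (by rw [mgfBase]; ring)

@[fun_prop]
lemma continuous_mgfBase : Continuous fun p : ℝ × ℝ × ℝ => mgfBase p.1 p.2.1 p.2.2 := by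
  unfold mgfBase
  fun_prop

end mgfBase

/-- The joint moment generating function, at `u`, of the walk with increments `α` that started at
`y` a time `τ` ago. -/
noncomputable def jointMgf {ι : Type*} [Fintype ι] (α u : ι → ℝ) (τ : ℝ) (y : ι → ℝ) : ℝ :=
  ∏ i, mgfBase (α i) (u i) τ ^ (-(y i / α i))

section jointMgf

variable {ι : Type*} [Fintype ι] {α u u' y : ι → ℝ} {τ : ℝ}

lemma jointMgf_zero_time (hα : ∀ i, α i ≠ 0) (u y : ι → ℝ) :
    jointMgf α u 0 y = Real.exp (∑ i, u i * y i) := by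
  rw [jointMgf, Real.exp_sum]
  refine Finset.prod_congr rfl fun i _ => ?_
  rw [mgfBase_zero_right, ← Real.exp_mul]
  have := hα i
  congr 1
  field_simp

lemma jointMgf_zero (α : ι → ℝ) (τ : ℝ) (y : ι → ℝ) : jointMgf α 0 τ y = 1 := by
  simp [jointMgf, mgfBase_zero_left]

lemma jointMgf_single [DecidableEq ι] (α y : ι → ℝ) (i : ι) (u τ : ℝ) :
    jointMgf α (Pi.single i u) τ y = mgfBase (α i) u τ ^ (-(y i / α i)) := by
  rw [jointMgf, Finset.prod_eq_single i]
  · simp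
  · intro k _ hk
    simp [hk, mgfBase_zero_left]
  · simp

lemma jointMgf_pos (h : ∀ i, 0 < mgfBase (α i) (u i) τ) (y : ι → ℝ) : 0 < jointMgf α u τ y :=
  Finset.prod_pos fun i _ => Real.rpow_pos_of_pos (h i) _

lemma jointMgf_le_exp_mul (hα : ∀ i, 0 < α i) (hτ : 0 ≤ τ) (hu : u ≤ u')
    (h : ∀ i, 0 < mgfBase (α i) (u' i) τ) (hy : 0 ≤ y) :
    jointMgf α u τ y ≤ Real.exp (-∑ i, (u' i - u i) * y i) * jointMgf α u' τ y := by
  have hpos : ∀ i, 0 < mgfBase (α i) (u i) τ := fun i =>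
    pos_of_mul_pos_right ((h i).trans_le (mgfBase_le_exp_mul (hα i).le hτ (hu i)))
      (Real.exp_pos _).le
  rw [jointMgf, jointMgf, ← Finset.sum_neg_distrib, Real.exp_sum, ← Finset.prod_mul_distrib]
  exact Finset.prod_le_prod (fun i _ => Real.rpow_nonneg (hpos i).le _) fun i _ =>
    mgfBase_rpow_le (hα i) hτ (hu i) (h i) (hy i)

lemma jointMgf_add_single [DecidableEq ι] {i : ι} (hα : α i ≠ 0)
    (h : mgfBase (α i) (u i) τ ≠ 0) (y : ι → ℝ) :
    jointMgf α u τ (y + Pi.single i (α i)) = jointMgf α u τ y / mgfBase (α i) (u i) τ := by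
  unfold jointMgf
  rw [← Finset.mul_prod_erase _ _ (Finset.mem_univ i),
    ← Finset.mul_prod_erase Finset.univ (fun i => mgfBase (α i) (u i) τ ^ (-(y i / α i)))
      (Finset.mem_univ i), mul_div_right_comm]
  congr 1
  · rw [← Real.rpow_sub_one h, Pi.add_apply, Pi.single_eq_same, add_div, div_self hα, neg_add,
      sub_eq_add_neg]
  · refine Finset.prod_congr rfl fun k hk => ?_
    simp [Pi.single_eq_of_ne (Finset.ne_of_mem_erase hk)]

-- This is the backward equation of the walk, in the form for a clock of rate `∑ j, y j`.
lemma hasDerivAt_jointMgf [DecidableEq ι] (hα : ∀ i, α i ≠ 0)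
    (h : ∀ i, mgfBase (α i) (u i) τ ≠ 0) (hy : ∑ i, y i ≠ 0) :
    HasDerivAt (fun τ => jointMgf α u τ y)
      ((∑ j, y j) * (∑ i, y i / (∑ j, y j) * jointMgf α u τ (y + Pi.single i (α i)) -
        jointMgf α u τ y)) τ := by
  have hprod := HasDerivAt.fun_finsetProd (u := Finset.univ)
    (f := fun i τ => mgfBase (α i) (u i) τ ^ (-(y i / α i)))
    fun i _ => (hasDerivAt_mgfBase (α i) (u i) τ).rpow_const (p := -(y i / α i)) (Or.inl (h i))
  refine hprod.congr_deriv ?_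
  rw [mul_sub, Finset.mul_sum, Finset.sum_mul, ← Finset.sum_sub_distrib]
  refine Finset.sum_congr rfl fun i _ => ?_
  rw [jointMgf_add_single (hα i) (h i), jointMgf,
    ← Finset.mul_prod_erase _ _ (Finset.mem_univ i), smul_eq_mul, Real.rpow_sub_one (h i)]
  have := hα i
  have := h i
  field_simp

lemma measurable_uncurry_ofReal_jointMgf (α u : ι → ℝ) :
    Measurable (Function.uncurry fun τ y => ENNReal.ofReal (jointMgf α u τ y)) := by
  have hbase : ∀ i, Measurable fun p : ℝ × (ι → ℝ) => mgfBase (α i) (u i) p.1 := fun i =>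
    (continuous_mgfBase.comp (g := fun p : ℝ × ℝ × ℝ => mgfBase p.1 p.2.1 p.2.2)
      (f := fun p : ℝ × (ι → ℝ) => (α i, u i, p.1)) (by fun_prop)).measurable
  exact (Finset.measurable_fun_prod _ fun i _ => (hbase i).pow (by fun_prop)).ennreal_ofReal

end jointMgf

section Diagonal

variable {Ω : Type*} {c : ℕ} {α u x : Fin c → ℝ} {t : ℝ}

lemma isTenable_diagonal (hα : 0 ≤ α) (hx : 0 < x) : IsTenable (Matrix.diagonal α) x := by
  refine fun I n => hx.trans_le (le_add_of_nonneg_right (Finset.sum_nonneg fun k _ => ?_))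
  rw [Matrix.row_diagonal]
  exact (Pi.single_nonneg (α := fun _ : Fin c => ℝ)).2 (hα (I k))

lemma sum_polyaPosition_diagonal_div (hα : ∀ i, α i ≠ 0) (x : Fin c → ℝ) (I : ℕ → Ω → Fin c)
    (n : ℕ) (ω : Ω) :
    ∑ i, polyaPosition (Matrix.diagonal α) x I n ω i / α i = ∑ i, x i / α i + n := by
  have hstep : ∀ j, ∑ i, (Pi.single j (α j) : Fin c → ℝ) i / α i = 1 := fun j => by
    rw [Finset.sum_eq_single j (fun k _ hk => by simp [hk]) (by simp), Pi.single_eq_same,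
      div_self (hα j)]
  induction n with
  | zero => simp [polyaPosition_zero]
  | succ n ih =>
    simp only [polyaPosition_succ, Matrix.row_diagonal, Pi.add_apply, add_div,
      Finset.sum_add_distrib, ih, hstep, Nat.cast_succ, add_assoc]

lemma solvesFirstRenewal_jointMgf (hα : ∀ i, 0 < α i) (hu : ∀ i, 0 < mgfBase (α i) (u i) t) :
    SolvesFirstRenewal (Matrix.diagonal α) t (fun y => ENNReal.ofReal (Real.exp (∑ i, u i * y i)))
      fun τ y => ENNReal.ofReal (jointMgf α u τ y) := by
  intro τ hτ y hy
  have hr : 0 < ∑ j, y j := Fintype.sum_pos hy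
  have hα₀ : ∀ i, α i ≠ 0 := fun i => (hα i).ne'
  have hpos : ∀ σ ≤ τ, ∀ i, 0 < mgfBase (α i) (u i) σ := fun σ hσ i =>
    mgfBase_pos_of_le (hα i).le (hσ.trans hτ.2) (hu i)
  have hterm : ∀ σ ≤ τ, ∀ i, 0 ≤ y i / (∑ j, y j) * jointMgf α u σ (y + Pi.single i (α i)) :=
    fun σ hσ i => mul_nonneg (div_nonneg (hy.le i) hr.le) (jointMgf_pos (hpos σ hσ) _).le
  have hderiv : ∀ σ ∈ Set.Icc 0 τ, ∀ z : Fin c → ℝ, 0 < z → HasDerivAt (fun σ => jointMgf α u σ z)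
      ((∑ j, z j) * (∑ i, z i / (∑ j, z j) * jointMgf α u σ (z + Pi.single i (α i)) -
        jointMgf α u σ z)) σ := fun σ hσ z hz =>
    hasDerivAt_jointMgf hα₀ (fun i => (hpos σ hσ.2 i).ne') (Fintype.sum_pos hz).ne'
  have hcont : ContinuousOn (fun σ => ∑ i, y i / (∑ j, y j) *
      jointMgf α u σ (y + Pi.single i (α i))) (Set.Icc 0 τ) :=
    continuousOn_finsetSum _ fun i _ => continuousOn_const.mul fun σ hσ =>
      (hderiv σ hσ _ (hy.trans_le (le_add_of_nonneg_right
        (Pi.single_nonneg.2 (hα i).le)))).continuousAt.continuousWithinAt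
  refine Eq.trans (lintegral_congr_ae ?_) (lintegral_expMeasure_of_hasDerivAt hr hτ.1
    (jointMgf_pos (hpos 0 hτ.1) y).le hcont (fun σ hσ => Finset.sum_nonneg fun i _ =>
      hterm σ hσ.2 i) fun σ hσ => hderiv σ hσ y hy)
  filter_upwards [ae_expMeasure_pos hr] with w hw
  split_ifs
  · rw [← Finset.sum_mul, sum_ofReal_div_sum hy, one_mul, jointMgf_zero_time hα₀]
  · rw [ENNReal.ofReal_sum_of_nonneg fun i _ => hterm _ (by linarith) i]
    refine Finset.sum_congr rfl fun i _ => ?_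
    rw [Matrix.row_diagonal, ENNReal.ofReal_mul (div_nonneg (hy.le i) hr.le)]

end Diagonal

namespace IsDrivenBy

variable {Ω : Type*} [MeasurableSpace Ω] {c : ℕ} {P : Measure Ω} [IsProbabilityMeasure P]
  {α u x : Fin c → ℝ} {X : ℝ≥0 → Ω → Fin c → ℝ} {W : ℕ → Ω → ℝ} {I : ℕ → Ω → Fin c}

lemma renewalRemainder_jointMgf_le (h : IsDrivenBy P (Matrix.diagonal α) x X W I)
    (hα : ∀ i, 0 < α i) (hx : 0 < x) {t : ℝ} (ht : 0 ≤ t) {ε : ℝ} (hε : 0 ≤ ε)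
    (hu : ∀ i, 0 < mgfBase (α i) (u i + ε / α i) t) (n : ℕ) :
    renewalRemainder P (Matrix.diagonal α) x W I t
        (fun τ y => ENNReal.ofReal (jointMgf α u τ y)) n ≤
      ENNReal.ofReal (Real.exp (-(ε * n))) *
        ENNReal.ofReal (jointMgf α (fun i => u i + ε / α i) t x) := by
  have hA : IsTenable (Matrix.diagonal α) x := isTenable_diagonal (fun i => (hα i).le) hx
  have hm : MeasurableSet {ω | renewalEpoch W n ω ≤ t} :=
    measurableSet_le (h.measurable_renewalEpoch n) measurable_const
  calc renewalRemainder P (Matrix.diagonal α) x W I t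
        (fun τ y => ENNReal.ofReal (jointMgf α u τ y)) n
      ≤ ENNReal.ofReal (Real.exp (-(ε * n))) * renewalRemainder P (Matrix.diagonal α) x W I t
          (fun τ y => ENNReal.ofReal (jointMgf α (fun i => u i + ε / α i) τ y)) n := by
        rw [renewalRemainder, renewalRemainder, ← lintegral_const_mul' _ _ ENNReal.ofReal_ne_top]
        refine setLIntegral_mono_ae' hm ?_
        filter_upwards [h.ae_renewalEpoch_nonneg hA n] with ω hω hωt
        have hposn := hA.polyaPosition_pos I n ω
        have hu' : ∀ i, 0 < mgfBase (α i) (u i + ε / α i) (t - renewalEpoch W n ω) := fun i =>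
          mgfBase_pos_of_le (hα i).le (by linarith) (hu i)
        rw [← ENNReal.ofReal_mul (Real.exp_pos _).le]
        refine ENNReal.ofReal_le_ofReal ((jointMgf_le_exp_mul hα (sub_nonneg.2 hωt) (fun i =>
          le_add_of_nonneg_right (div_nonneg hε (hα i).le)) hu' hposn.le).trans ?_)
        refine mul_le_mul_of_nonneg_right (Real.exp_le_exp.2 (neg_le_neg ?_))
          (jointMgf_pos hu' _).le
        simp_rw [add_sub_cancel_left, div_mul_eq_mul_div, mul_div_assoc, ← Finset.mul_sum,
          sum_polyaPosition_diagonal_div fun i => (hα i).ne']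
        exact mul_le_mul_of_nonneg_left (le_add_of_nonneg_left
          (Finset.sum_nonneg fun i _ => div_nonneg (hx.le i) (hα i).le)) hε
    _ ≤ _ := by
        gcongr
        exact le_add_self.trans_eq (h.sum_setLIntegral_sojourn_add_renewalRemainder hA ht
          (by fun_prop) (measurable_uncurry_ofReal_jointMgf α _)
          (solvesFirstRenewal_jointMgf hα hu) n)

lemma tendsto_renewalRemainder_jointMgf (h : IsDrivenBy P (Matrix.diagonal α) x X W I)
    (hα : ∀ i, 0 < α i) (hx : 0 < x) {t : ℝ} (ht : 0 ≤ t) (hu : ∀ i, 0 < mgfBase (α i) (u i) t) :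
    Tendsto (renewalRemainder P (Matrix.diagonal α) x W I t
      fun τ y => ENNReal.ofReal (jointMgf α u τ y)) atTop (𝓝 0) := by
  obtain ⟨ε, hu', hε⟩ : ∃ ε, (∀ i, 0 < mgfBase (α i) (u i + ε / α i) t) ∧ 0 < ε := by
    have hcont : ∀ i, Tendsto (fun ε => mgfBase (α i) (u i + ε / α i) t) (𝓝[>] 0)
        (𝓝 (mgfBase (α i) (u i) t)) := fun i => by
      have : Continuous fun ε => mgfBase (α i) (u i + ε / α i) t := by
        unfold mgfBase
        fun_prop
      simpa using (this.tendsto 0).mono_left nhdsWithin_le_nhds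
    exact ((eventually_all.2 fun i => (hcont i).eventually (lt_mem_nhds (hu i))).and
      self_mem_nhdsWithin).exists
  have hexp : Tendsto (fun n : ℕ => Real.exp (-(ε * n))) atTop (𝓝 0) :=
    Real.tendsto_exp_neg_atTop_nhds_zero.comp (tendsto_natCast_atTop_atTop.const_mul_atTop hε)
  refine tendsto_of_tendsto_of_tendsto_of_le_of_le tendsto_const_nhds ?_ (fun _ => zero_le)
    (h.renewalRemainder_jointMgf_le hα hx ht hε.le hu')
  simpa using ENNReal.Tendsto.mul_const (ENNReal.tendsto_ofReal hexp) (Or.inr ENNReal.ofReal_ne_top)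

lemma ae_mem_iUnion_sojourn_diagonal (h : IsDrivenBy P (Matrix.diagonal α) x X W I)
    (hα : ∀ i, 0 < α i) (hx : 0 < x) {t : ℝ} (ht : 0 ≤ t) :
    ∀ᵐ ω ∂P, ω ∈ ⋃ n, sojourn W t n := by
  have hu : ∀ i, 0 < mgfBase (α i) ((0 : Fin c → ℝ) i) t := by simp [mgfBase_zero_left]
  have hone : (fun y : Fin c → ℝ => ENNReal.ofReal (Real.exp (∑ i, (0 : Fin c → ℝ) i * y i))) =
      1 := by
    ext
    simp
  exact h.ae_mem_iUnion_sojourn (isTenable_diagonal (fun i => (hα i).le) hx) ht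
    (measurable_uncurry_ofReal_jointMgf α 0) (hone ▸ solvesFirstRenewal_jointMgf hα hu)
    (h.tendsto_renewalRemainder_jointMgf hα hx ht hu) (by simp [jointMgf_zero])

variable {t : ℝ≥0}

lemma lintegral_exp_sum (h : IsDrivenBy P (Matrix.diagonal α) x X W I)
    (hα : ∀ i, 0 < α i) (hx : 0 < x) (hu : ∀ i, 0 < mgfBase (α i) (u i) t) :
    ∫⁻ ω, ENNReal.ofReal (Real.exp (∑ i, u i * X t ω i)) ∂P =
      ENNReal.ofReal (jointMgf α u t x) := by
  have hA : IsTenable (Matrix.diagonal α) x := isTenable_diagonal (fun i => (hα i).le) hx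
  rw [h.lintegral_comp_eq_tsum hA (h.ae_mem_iUnion_sojourn_diagonal hα hx t.2)
    fun y => ENNReal.ofReal (Real.exp (∑ i, u i * y i))]
  exact h.tsum_setLIntegral_sojourn hA t.2 (by fun_prop)
    (measurable_uncurry_ofReal_jointMgf α u) (solvesFirstRenewal_jointMgf hα hu)
    (h.tendsto_renewalRemainder_jointMgf hα hx t.2 hu)

lemma aemeasurable_diagonal (h : IsDrivenBy P (Matrix.diagonal α) x X W I) (hα : ∀ i, 0 < α i)
    (hx : 0 < x) : AEMeasurable (X t) P :=
  h.aemeasurable (h.ae_mem_iUnion_sojourn_diagonal hα hx t.2)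

lemma ae_nonneg_diagonal (h : IsDrivenBy P (Matrix.diagonal α) x X W I) (hα : ∀ i, 0 < α i)
    (hx : 0 < x) : ∀ᵐ ω ∂P, 0 ≤ X t ω := by
  filter_upwards [h.ae_exists_eq_polyaPosition (h.ae_mem_iUnion_sojourn_diagonal hα hx t.2)]
    with ω ⟨n, hn⟩
  rw [hn]
  exact ((isTenable_diagonal (fun i => (hα i).le) hx).polyaPosition_pos I n ω).le

lemma integrable_exp_sum (h : IsDrivenBy P (Matrix.diagonal α) x X W I)
    (hα : ∀ i, 0 < α i) (hx : 0 < x) (hu : ∀ i, 0 < mgfBase (α i) (u i) t) :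
    Integrable (fun ω => Real.exp (∑ i, u i * X t ω i)) P := by
  have hX := h.aemeasurable_diagonal hα hx (t := t)
  refine (lintegral_ofReal_ne_top_iff_integrable ?_ (ae_of_all _ fun _ => (Real.exp_pos _).le)).1 ?_
  · exact AEMeasurable.aestronglyMeasurable (by fun_prop)
  · rw [h.lintegral_exp_sum hα hx hu]
    exact ENNReal.ofReal_ne_top

lemma integral_exp_sum (h : IsDrivenBy P (Matrix.diagonal α) x X W I)
    (hα : ∀ i, 0 < α i) (hx : 0 < x) (hu : ∀ i, 0 < mgfBase (α i) (u i) t) :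
    ∫ ω, Real.exp (∑ i, u i * X t ω i) ∂P = jointMgf α u t x := by
  rw [integral_eq_lintegral_of_nonneg_ae (ae_of_all _ fun _ => (Real.exp_pos _).le)
    (h.integrable_exp_sum hα hx hu).aestronglyMeasurable, h.lintegral_exp_sum hα hx hu,
    ENNReal.toReal_ofReal (jointMgf_pos hu x).le]

lemma integrable_exp_and_mgf_eq (h : IsDrivenBy P (Matrix.diagonal α) x X W I)
    (hα : ∀ i, 0 < α i) (hx : 0 < x) (i : Fin c) {v : ℝ} (hv : 0 < mgfBase (α i) v t) :
    Integrable (fun ω => Real.exp (v * X t ω i)) P ∧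
      mgf (fun ω => X t ω i) P v = mgfBase (α i) v t ^ (-(x i / α i)) := by
  have hpos : ∀ k, 0 < mgfBase (α k) ((Pi.single i v : Fin c → ℝ) k) t := by
    intro k
    rcases eq_or_ne k i with rfl | hk
    · simpa using hv
    · simp [hk, mgfBase_zero_left]
  have hsum : ∀ ω, ∑ k, (Pi.single i v : Fin c → ℝ) k * X t ω k = v * X t ω i := fun ω => by
    rw [Finset.sum_eq_single i] <;> simp +contextual
  have hint := h.integrable_exp_sum hα hx hpos
  have hmgf := h.integral_exp_sum hα hx hpos
  simp only [hsum, jointMgf_single] at hint hmgf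
  exact ⟨hint, hmgf⟩

end IsDrivenBy

section Scaling

-- The convergence is the derivative of `ε ↦ exp (-(a * s * ε))` at `0`, taken along
-- `ε = exp (-(a * t))`.
lemma tendsto_mgfBase_scaled {a : ℝ} (ha : 0 < a) (s : ℝ) :
    Tendsto (fun t => mgfBase a (s * Real.exp (-(a * t))) t) atTop (𝓝 (1 - a * s)) := by
  have hderiv : HasDerivAt (fun ε : ℝ => Real.exp (-(a * s * ε))) (-(a * s)) 0 := by
    have hlin : HasDerivAt (fun ε : ℝ => -(a * s * ε)) (-(a * s)) 0 := by
      simpa using (hasDerivAt_id (0 : ℝ)).const_mul (-(a * s))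
    simpa using hlin.exp
  have hscale : Tendsto (fun t : ℝ => Real.exp (-(a * t))) atTop (𝓝[≠] 0) :=
    tendsto_nhdsWithin_iff.2 ⟨Real.tendsto_exp_neg_atTop_nhds_zero.comp
      (tendsto_id.const_mul_atTop ha), Eventually.of_forall fun t => (Real.exp_pos _).ne'⟩
  have hslope := ((hasDerivAt_iff_tendsto_slope_zero.1 hderiv).comp hscale).const_add 1
  rw [← sub_eq_add_neg] at hslope
  refine hslope.congr fun t => ?_
  simp only [Function.comp_apply, zero_add, mul_zero, neg_zero, Real.exp_zero, smul_eq_mul, mgfBase]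
  rw [← Real.exp_neg, neg_neg, mul_assoc a s]
  ring

lemma one_sub_mul_le_mgfBase_scaled (a s t : ℝ) :
    1 - a * s ≤ mgfBase a (s * Real.exp (-(a * t))) t := by
  have hlin : 1 - Real.exp (-(a * (s * Real.exp (-(a * t))))) ≤ a * (s * Real.exp (-(a * t))) := by
    linarith [Real.add_one_le_exp (-(a * (s * Real.exp (-(a * t)))))]
  have hcancel : Real.exp (a * t) * (a * (s * Real.exp (-(a * t)))) = a * s := by
    rw [Real.exp_neg]
    field_simp
  rw [mgfBase]
  linarith [mul_le_mul_of_nonneg_left hlin (Real.exp_pos (a * t)).le]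

lemma mgfBase_scaled_pos {a s : ℝ} (hs : a * s < 1) (t : ℝ) :
    0 < mgfBase a (s * Real.exp (-(a * t))) t :=
  (sub_pos.2 hs).trans_le (one_sub_mul_le_mgfBase_scaled a s t)

lemma tendsto_mgfBase_scaled_rpow {a s : ℝ} (ha : 0 < a) (hs : a * s < 1) (p : ℝ) :
    Tendsto (fun t : ℝ≥0 => mgfBase a (s * Real.exp (-(a * t))) t ^ p) atTop
      (𝓝 ((1 - a * s) ^ p)) :=
  ((tendsto_mgfBase_scaled ha s).comp (NNReal.tendsto_coe_atTop.2 tendsto_id)).rpow_const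
    (Or.inl (sub_pos.2 hs).ne')

end Scaling

namespace IsDrivenBy

variable {Ω : Type*} [MeasurableSpace Ω] {c : ℕ} {P : Measure Ω} [IsProbabilityMeasure P]
  {α x : Fin c → ℝ} {X : ℝ≥0 → Ω → Fin c → ℝ} {W : ℕ → Ω → ℝ} {I : ℕ → Ω → Fin c}

lemma aemeasurable_scaled (h : IsDrivenBy P (Matrix.diagonal α) x X W I) (hα : ∀ i, 0 < α i)
    (hx : 0 < x) (t : ℝ≥0) : AEMeasurable (fun ω i => X t ω i / Real.exp (α i * t)) P := by
  have hX := h.aemeasurable_diagonal hα hx (t := t)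
  fun_prop

lemma ae_nonneg_scaled (h : IsDrivenBy P (Matrix.diagonal α) x X W I) (hα : ∀ i, 0 < α i)
    (hx : 0 < x) (t : ℝ≥0) : ∀ᵐ ω ∂P, 0 ≤ fun i => X t ω i / Real.exp (α i * t) := by
  filter_upwards [h.ae_nonneg_diagonal hα hx (t := t)] with ω hω i
  exact div_nonneg (hω i) (Real.exp_pos _).le

lemma integrable_exp_and_mgf_eq_scaled (h : IsDrivenBy P (Matrix.diagonal α) x X W I)
    (hα : ∀ i, 0 < α i) (hx : 0 < x) (i : Fin c) {s : ℝ} (hs : α i * s < 1) (t : ℝ≥0) :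
    Integrable (fun ω => Real.exp (s * (X t ω i / Real.exp (α i * t)))) P ∧
      mgf (fun ω => X t ω i / Real.exp (α i * t)) P s =
        mgfBase (α i) (s * Real.exp (-(α i * t))) t ^ (-(x i / α i)) := by
  have hmgf := h.integrable_exp_and_mgf_eq hα hx i (mgfBase_scaled_pos hs t)
  have hscale : ∀ ω, s * Real.exp (-(α i * t)) * X t ω i = s * (X t ω i / Real.exp (α i * t)) :=
    fun ω => by rw [Real.exp_neg]; ring
  simpa only [mgf, hscale] using hmgf

lemma tendsto_mgf_scaled (h : IsDrivenBy P (Matrix.diagonal α) x X W I) (hα : ∀ i, 0 < α i)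
    (hx : 0 < x) (i : Fin c) {s : ℝ} (hs : α i * s < 1) :
    Tendsto (fun t : ℝ≥0 => mgf (fun ω => X t ω i / Real.exp (α i * t)) P s) atTop
      (𝓝 ((1 - α i * s) ^ (-(x i / α i)))) := by
  simp_rw [fun t => (h.integrable_exp_and_mgf_eq_scaled hα hx i hs t).2]
  exact tendsto_mgfBase_scaled_rpow (hα i) hs _

lemma isTightMeasureSet_scaled (h : IsDrivenBy P (Matrix.diagonal α) x X W I)
    (hα : ∀ i, 0 < α i) (hx : 0 < x) : IsTightMeasureSet
      (Set.range fun t : ℝ≥0 => P.map fun ω i => X t ω i / Real.exp (α i * t)) := by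
  refine isTightMeasureSet_pi fun i => ?_
  have hm := h.aemeasurable_scaled hα hx
  have hs : α i * (2 * α i)⁻¹ < 1 := by
    have := hα i
    field_simp
    norm_num
  have hmgf := h.integrable_exp_and_mgf_eq_scaled hα hx i hs
  have htight : IsTightMeasureSet
      (Set.range fun t : ℝ≥0 => P.map fun ω => X t ω i / Real.exp (α i * t)) := by
    refine isTightMeasureSet_range_map_of_mgf_le (fun t => aemeasurable_pi_iff.1 (hm t) i)
      (fun t => (h.ae_nonneg_scaled hα hx t).mono fun ω hω => hω i)
      (inv_pos.2 (mul_pos two_pos (hα i))) (fun t => (hmgf t).1)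
      (C := (1 - α i * (2 * α i)⁻¹) ^ (-(x i / α i))) fun t => ?_
    rw [(hmgf t).2]
    exact Real.rpow_le_rpow_of_nonpos (sub_pos.2 hs) (one_sub_mul_le_mgfBase_scaled _ _ _)
      (neg_nonpos.2 (div_nonneg (hx.le i) (hα i).le))
  rw [← Set.range_comp]
  simpa only [Function.comp_def, AEMeasurable.map_map_of_aemeasurable
    (measurable_pi_apply i).aemeasurable (hm _), Function.eval] using htight

lemma tendsto_integral_exp_sum_scaled (h : IsDrivenBy P (Matrix.diagonal α) x X W I)
    (hα : ∀ i, 0 < α i) (hx : 0 < x) {s : Fin c → ℝ} (hs : ∀ i, α i * s i < 1) :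
    Tendsto (fun t : ℝ≥0 => ∫ ω, Real.exp (∑ i, s i * (X t ω i / Real.exp (α i * t))) ∂P) atTop
      (𝓝 (∏ i, (1 - α i * s i) ^ (-(x i / α i)))) := by
  have hscale : ∀ (t : ℝ≥0) ω i, s i * (X t ω i / Real.exp (α i * t)) =
      s i * Real.exp (-(α i * t)) * X t ω i := fun t ω i => by
    rw [Real.exp_neg]
    ring
  simp_rw [hscale, fun t : ℝ≥0 => h.integral_exp_sum hα hx fun i => mgfBase_scaled_pos (hs i) t]
  exact tendsto_finsetProd _ fun i _ => tendsto_mgfBase_scaled_rpow (hα i) (hs i) _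

lemma tendstoInDistribution_scaled (h : IsDrivenBy P (Matrix.diagonal α) x X W I)
    (hα : ∀ i, 0 < α i) (hx : 0 < x) :
    TendstoInDistribution (fun (t : ℝ≥0) ω (i : Fin c) => X t ω i / Real.exp (α i * t)) atTop
      (id : (Fin c → ℝ) → (Fin c → ℝ)) (fun _ => P)
      (Measure.pi fun i => gammaLaw (x i / α i) (α i)) := by
  refine tendstoInDistribution_of_tendsto_integral_exp (h.aemeasurable_scaled hα hx)
    aemeasurable_id (h.ae_nonneg_scaled hα hx) (ae_nonneg_pi fun i => ae_nonneg_gammaLaw _ _)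
    (h.isTightMeasureSet_scaled hα hx) fun s hs => ?_
  have hs' : ∀ i, α i * s i < 1 := fun i =>
    (mul_nonpos_of_nonneg_of_nonpos (hα i).le (hs i)).trans_lt one_pos
  simp only [id, integral_exp_sum_pi,
    fun i => mgf_gammaLaw (div_nonneg (hx.le i) (hα i).le) (hα i) (hs' i)]
  exact h.tendsto_integral_exp_sum_scaled hα hx hs'

end IsDrivenBy

theorem mainTheorem6 {Ω : Type*} [MeasurableSpace Ω] (P : Measure Ω) [IsProbabilityMeasure P]
    {c : ℕ} (α x : Fin c → ℝ) (hα : ∀ i, 0 < α i) (hx : ∀ i, 0 ≤ x i) (hx₀ : x ≠ 0)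
    (X : ℝ≥0 → Ω → Fin c → ℝ)
    (hX : IsContinuumPolyaWalk P (Matrix.diagonal α) x X) :
    -- the moment generating function of each coordinate, wherever the base is positive
    (∀ (i : Fin c) (t : ℝ≥0) (u : ℝ),
      0 < 1 - Real.exp (α i * t) * (1 - Real.exp (-(α i * u))) →
        Integrable (fun ω => Real.exp (u * X t ω i)) P ∧
        mgf (fun ω => X t ω i) P u =
          (1 - Real.exp (α i * t) * (1 - Real.exp (-(α i * u)))) ^ (-(x i / α i))) ∧
    -- the limit of the moment generating function of the scaled coordinate
    (∀ (i : Fin c) (s : ℝ), α i * s < 1 →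
      Tendsto (fun t : ℝ≥0 => mgf (fun ω => X t ω i / Real.exp (α i * t)) P s) atTop
        (𝓝 ((1 - α i * s) ^ (-(x i / α i))))) ∧
    -- convergence in distribution of each scaled coordinate
    (∀ i : Fin c,
      TendstoInDistribution (fun (t : ℝ≥0) ω => X t ω i / Real.exp (α i * t)) atTop
        (id : ℝ → ℝ) (fun _ => P) (gammaLaw (x i / α i) (α i))) ∧
    -- joint convergence in distribution, to a vector with independent coordinates
    TendstoInDistribution (fun (t : ℝ≥0) ω (i : Fin c) => X t ω i / Real.exp (α i * t)) atTop
      (id : (Fin c → ℝ) → (Fin c → ℝ)) (fun _ => P)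
      (Measure.pi fun i => gammaLaw (x i / α i) (α i)) := by
  obtain ⟨W, I, h⟩ := hX
  have hx' : 0 < x := lt_of_le_of_ne hx hx₀.symm
  have hjoint := h.tendstoInDistribution_scaled hα hx'
  exact ⟨fun i t u hu => h.integrable_exp_and_mgf_eq hα hx' i hu,
    fun i s hs => h.tendsto_mgf_scaled hα hx' i hs,
    fun i => tendstoInDistribution_eval_of_pi hjoint i, hjoint⟩
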